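/- Setup. All natural numbers $d,m,l,r$ are positive. Let $\mathcal T\subset\mathbb R^d$ be compact. For $j=1,\dots,m$ let $H_j=[3j-1,3j+1]^d$, let $H_{m+1}\subset\mathbb R^d$ be a finite set of $l$ points outside these cubes, $S=\bigcup_{i=1}^{m+1}H_i$, and let $\nu$ be the measure on $S$ that is Lebesgue measure on each cube $H_j$, $j\le m$, and has mass one at each point of $H_{m+1}$. Put $X=L^2(S,\nu)$, with inner product $\langle\cdot,\cdot\rangle$ and norm $\|\cdot\|$. A parameter is $\theta=(a,b,c)$ with $a:\mathcal T\to X$ and $b:\mathcal T\to\mathbb R$ continuous and $c\in X$. Suppose that for some $s^*\in H_{m+1}$ we have $a(t)(s^*)=c(s^*)=1$ for all $t\in\mathcal T$, and that $\int a\,d\lambda=c$ ($\nu$-a.s.) for some finite positive Borel measure $\lambda$ on $\mathcal T$. Let $$\beta(\theta)=\inf\{\langle c,x\rangle: x\in X,\ \langle a(t),x\rangle\ge b(t)\ \ \forall t\in\mathcal T\}.$$ For $\gamma>0$ and a closed subspace $V\subseteq X$ put $$\beta_V(\theta;\gamma)=\inf_{x\in V,\ \|x\|\le\gamma}\Big[\langle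 c,x\rangle+\big(\max_{t\in\mathcal T}(b(t)-\langle a(t),x\rangle)\big)^+\Big],$$ $\beta_\infty(\theta;\gamma)=\beta_X(\theta;\gamma)$ and $\Delta(\theta;\gamma)=\beta_\infty(\theta;\gamma)-\beta(\theta)$. For $J=(k_1,\dots,k_m)$, $k_i\in\mathbb N\cup\{0\}$, let $\mathbf P_J$ be the space of all $f\in X$ whose restriction to $H_i$ is a polynomial of total degree at most $k_i$, $i=1,\dots,m$, let $\mathbf p_J$ be the orthogonal projection of $X$ onto $\mathbf P_J$, and $\beta_J=\beta_{\mathbf P_J}$. Theorem. (1) For every $\hat\theta=(\hat a,\hat b,\hat c)\in C(\mathcal T,X)\times C(\mathcal T)\times X$, every $J$ and every $\gamma>0$, $$-\gamma(\delta^a+\delta^c)-\delta^b\ \le\ \beta_J(\hat\theta;\gamma)-\beta(\theta)\ \le\ \gamma(\delta^a+\delta^c+\delta^p)+\delta^b+\Delta(\theta;\gamma),$$ where $\delta^a=\sup_{t\in\mathcal T}\|\hat a(t)-a(t)\|$, $\delta^b=\sup_{t\in\mathcal T}|\hat b(t)-b(t)|$, $\delta^c=\|\hat c-c\|$ and $\delta^p=\|(I-\mathbf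 p_J)c\|+\max_{t\in\mathcal T}\|(I-\mathbf p_J)a(t)\|$. The same bounds hold if $\beta(\theta)$ is replaced, also in the definition of $\Delta$, by the value of the generalized optimal transport problem, $\sup_P\mathbb E_P[b(T)]$ over all Borel probability measures $P$ on $\mathcal T$ with $\mathbb E_P[a(T)]=c$ ($\nu$-a.s.). (2) For all $d$ and $r$ there is a constant $\tilde C>0$, depending only on $d$ and $r$, such that the following holds for all $m$, $H_{m+1}$, $\mathcal T$ and $\theta$ as above. If, on the interior of every cube $H_i$, $i\le m$, the functions $c$ and $a(t)$, $t\in\mathcal T$, belong to the Sobolev space $W^{r,2}$ with norm $\big(\sum_{|\alpha|\le r}\|D^\alpha f\|_{L^2}^2\big)^{1/2}$ at most $C>0$, and if $\kappa=\min_i k_i\ge r$, then $$\delta^p\le m\,C\,\tilde C\,\kappa^{-r}.$$ -/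

import Mathlib

open MeasureTheory

noncomputable section

/-! ## The parameter, the linear programs and the penalized problems

Everything in this section makes sense for an arbitrary real Hilbert space `X`; below `X` is
the space of square integrable functions on the index set of the moment restrictions. -/

/-- A parameter `θ = (a, b, c)`: a continuous constraint map `a : 𝒯 → X`, a continuous cost
`b : 𝒯 → ℝ`, and a vector `c ∈ X`. -/
structure Param {d : ℕ} (𝒯 : Set (Fin d → ℝ)) (X : Type) [TopologicalSpace X] where
  a : C(𝒯, X)
  b : C(𝒯, ℝ)
  c : X

namespace Param

variable {d : ℕ} {𝒯 : Set (Fin d → ℝ)} {X : Type} [NormedAddCommGroup X] [InnerProductSpace ℝ X]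

/-- The dual problem is feasible: some finite positive Borel measure `lam` on `𝒯` satisfies
`∫ a(t) dlam(t) = c` (an integral with values in `X`). -/
def DualFeasible (θ : Param 𝒯 X) : Prop :=
  ∃ lam : Measure 𝒯, IsFiniteMeasure lam ∧ ∫ t, θ.a t ∂lam = θ.c

/-- The value of the generalized optimal transport problem: the supremum of `E_P[b(T)]` over all
Borel probability measures `P` on `𝒯` with `E_P[a(T)] = c`. -/
def gotValue (θ : Param 𝒯 X) : ℝ :=
  sSup {v : ℝ | ∃ P : Measure 𝒯, IsProbabilityMeasure P ∧ ∫ t, θ.a t ∂P = θ.c ∧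
    v = ∫ t, θ.b t ∂P}

/-- The value of the program `inf ⟨c, x⟩` over all `x ∈ X` with `⟨a(t), x⟩ - b(t) ≥ 0` for
every `t ∈ 𝒯`. -/
def primalValue (θ : Param 𝒯 X) : ℝ :=
  sInf {v : ℝ | ∃ x : X, (∀ t : 𝒯, 0 ≤ inner ℝ (θ.a t) x - θ.b t) ∧ v = inner ℝ θ.c x}

/-- The penalty function `⟨c, x⟩ + (max_t (b(t) - ⟨a(t), x⟩))⁺`. -/
def penalty (θ : Param 𝒯 X) (x : X) : ℝ :=
  inner ℝ θ.c x + max (⨆ t : 𝒯, (θ.b t - inner ℝ (θ.a t) x)) 0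

/-- The penalized problem over the closed ball of radius `γ` in `X`. -/
def ballValue (θ : Param 𝒯 X) (γ : ℝ) : ℝ :=
  sInf (θ.penalty '' {x : X | ‖x‖ ≤ γ})

/-- The penalized problem over the part of a linear subspace `V` in the closed ball of
radius `γ`. -/
def subspaceBallValue (θ : Param 𝒯 X) (V : Submodule ℝ X) (γ : ℝ) : ℝ :=
  sInf (θ.penalty '' {x : X | ‖x‖ ≤ γ ∧ x ∈ V})

/-- The projection error `‖(I - p)c‖ + max_t ‖(I - p)a(t)‖` for the orthogonal projection `p`
onto `V`. -/
def projError (θ : Param 𝒯 X) (V : Submodule ℝ X) [V.HasOrthogonalProjection] : ℝ :=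
  ‖θ.c - V.starProjection θ.c‖ + ⨆ t : 𝒯, ‖θ.a t - V.starProjection (θ.a t)‖

/-- `δᵃ = sup_t ‖â(t) - a(t)‖`. -/
def errA (θ θhat : Param 𝒯 X) : ℝ := ⨆ t : 𝒯, ‖θhat.a t - θ.a t‖

/-- `δᵇ = sup_t |b̂(t) - b(t)|`. -/
def errB (θ θhat : Param 𝒯 X) : ℝ := ⨆ t : 𝒯, |θhat.b t - θ.b t|

/-- `δᶜ = ‖ĉ - c‖`. -/
def errC (θ θhat : Param 𝒯 X) : ℝ := ‖θhat.c - θ.c‖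

end Param

/-! ## The index set of the moment restrictions -/

/-- The closed cube of side `2` centred at `(t₀, …, t₀)`. -/
def cubeAt (d : ℕ) (t₀ : ℝ) : Set (Fin d → ℝ) :=
  Set.Icc (fun _ => -1 + t₀) (fun _ => 1 + t₀)

/-- An index set `S = H₁ ∪ … ∪ H_m ∪ H_{m+1}` in `ℝ^d`: the cubes `H_j` centred at
`(3j, …, 3j)`, `j = 1, …, m`, and a finite set `H_{m+1}` of points outside the cubes. -/
structure IndexSpace (d m : ℕ) where
  atoms : Finset (Fin d → ℝ)
  disjoint_cubes : ∀ (j : Fin m), ∀ s ∈ atoms, s ∉ cubeAt d (3 * ((j : ℕ) + 1 : ℝ))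

namespace IndexSpace

variable {d m : ℕ}

/-- The `j`-th cube (indices are shifted by one, `j = 0, …, m - 1`). -/
def cube (_S : IndexSpace d m) (j : Fin m) : Set (Fin d → ℝ) :=
  cubeAt d (3 * ((j : ℕ) + 1 : ℝ))

/-- The measure `ν`: Lebesgue measure on every cube, and mass one at every point of `H_{m+1}`.
It is regarded as a measure on `ℝ^d` that vanishes off `S`. -/
def nu (S : IndexSpace d m) : Measure (Fin d → ℝ) :=
  ∑ j, volume.restrict (S.cube j) + ∑ s ∈ S.atoms, Measure.dirac s

/-- The Hilbert space `X = L²(S, ν)`. -/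
abbrev X (S : IndexSpace d m) : Type := Lp ℝ 2 S.nu

theorem nu_cube_lt_top (S : IndexSpace d m) (j : Fin m) : S.nu (S.cube j) < ⊤ := by
  have h : S.nu Set.univ < ⊤ := by
    simp only [nu, Measure.coe_add, Measure.coe_finsetSum, Pi.add_apply, Finset.sum_apply,
      Measure.restrict_apply MeasurableSet.univ, Set.univ_inter]
    refine ENNReal.add_lt_top.2 ⟨ENNReal.sum_lt_top.2 fun i _ => ?_,
      ENNReal.sum_lt_top.2 fun i _ => by simp⟩
    exact isCompact_Icc.measure_lt_top
  exact lt_of_le_of_lt (measure_mono (Set.subset_univ _)) h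

/-- A polynomial function is square integrable on a cube. -/
theorem memLp_eval (S : IndexSpace d m) (j : Fin m) (p : MvPolynomial (Fin d) ℝ) :
    MemLp (fun s => MvPolynomial.eval s p) 2 (S.nu.restrict (S.cube j)) := by
  have hc : IsCompact (S.cube j) := isCompact_Icc
  have hcont : Continuous fun s : Fin d → ℝ => MvPolynomial.eval s p :=
    MvPolynomial.continuous_eval p
  obtain ⟨C, hC⟩ := hc.exists_bound_of_continuousOn hcont.continuousOn
  have : IsFiniteMeasure (S.nu.restrict (S.cube j)) :=
    ⟨by simpa using S.nu_cube_lt_top j⟩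
  refine MemLp.of_bound hcont.aestronglyMeasurable C ?_
  exact (ae_restrict_iff' measurableSet_Icc).2 (Filter.Eventually.of_forall hC)

/-- Polynomials as elements of `L²` of the `j`-th cube. -/
def polyToLp (S : IndexSpace d m) (j : Fin m) :
    MvPolynomial (Fin d) ℝ →ₗ[ℝ] Lp ℝ 2 (S.nu.restrict (S.cube j)) where
  toFun p := (S.memLp_eval j p).toLp _
  map_add' p q := by
    rw [← MemLp.toLp_add]
    exact MemLp.toLp_congr _ _ (Filter.Eventually.of_forall fun s => by simp)
  map_smul' r p := by
    rw [RingHom.id_apply, ← MemLp.toLp_const_smul]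
    exact MemLp.toLp_congr _ _ (Filter.Eventually.of_forall fun s => by
      simp [MvPolynomial.smul_eval])

/-- The sieve space `P_J`: all `f ∈ X` whose restriction to the `j`-th cube is (almost
everywhere) a polynomial of total degree at most `J j`, for every `j`. -/
def sieve (S : IndexSpace d m) (J : Fin m → ℕ) : Submodule ℝ S.X where
  carrier := {f | ∀ j, ∃ p : MvPolynomial (Fin d) ℝ, p.totalDegree ≤ J j ∧
    f =ᵐ[S.nu.restrict (S.cube j)] fun s => MvPolynomial.eval s p}
  zero_mem' := fun j => ⟨0, by simp, by
    filter_upwards [ae_restrict_of_ae (Lp.coeFn_zero ℝ 2 S.nu)] with s hs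
    rw [hs]
    simp⟩
  add_mem' := by
    intro f g hf hg j
    obtain ⟨p, hp, hfp⟩ := hf j
    obtain ⟨q, hq, hgq⟩ := hg j
    refine ⟨p + q, (MvPolynomial.totalDegree_add p q).trans (max_le hp hq), ?_⟩
    filter_upwards [ae_restrict_of_ae (Lp.coeFn_add f g), hfp, hgq] with s h1 h2 h3
    rw [h1, Pi.add_apply, h2, h3, map_add]
  smul_mem' := by
    intro r f hf j
    obtain ⟨p, hp, hfp⟩ := hf j
    refine ⟨r • p, (MvPolynomial.totalDegree_smul_le r p).trans hp, ?_⟩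
    filter_upwards [ae_restrict_of_ae (Lp.coeFn_smul r f), hfp] with s h1 h2
    rw [h1, Pi.smul_apply, h2, MvPolynomial.smul_eval, smul_eq_mul]

/-- The sieve space is closed, so that the orthogonal projection onto it exists. -/
theorem isClosed_sieve (S : IndexSpace d m) (J : Fin m → ℕ) :
    IsClosed (S.sieve J : Set S.X) := by
  have h : (S.sieve J : Set S.X) = ⋂ j, (LpToLpRestrictCLM (Fin d → ℝ) ℝ ℝ S.nu 2 (S.cube j)) ⁻¹'
      (((MvPolynomial.restrictTotalDegree (Fin d) ℝ (J j)).map (S.polyToLp j) :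
        Submodule ℝ (Lp ℝ 2 (S.nu.restrict (S.cube j)))) : Set _) := by
    ext f
    simp only [Set.mem_iInter, Set.mem_preimage, SetLike.mem_coe, Submodule.mem_map,
      MvPolynomial.mem_restrictTotalDegree]
    refine forall_congr' fun j => exists_congr fun p => and_congr_right fun _ => ?_
    have h1 := LpToLpRestrictCLM_coeFn (F := ℝ) (p := 2) (μ := S.nu) ℝ (S.cube j) f
    have h2 := (S.memLp_eval j p).coeFn_toLp
    constructor
    · intro hf
      exact Lp.ext (h2.trans (hf.symm.trans h1.symm))
    · intro hf
      have h3 : ((S.polyToLp j p : Lp ℝ 2 (S.nu.restrict (S.cube j))) : (Fin d → ℝ) → ℝ) =ᵐ[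
          S.nu.restrict (S.cube j)] fun s => MvPolynomial.eval s p := h2
      rw [hf] at h3
      exact h1.symm.trans h3
  rw [h]
  exact isClosed_iInter fun j => (Submodule.closed_of_finiteDimensional _).preimage
    (ContinuousLinearMap.continuous _)

instance (S : IndexSpace d m) (J : Fin m → ℕ) : (S.sieve J).HasOrthogonalProjection :=
  haveI : CompleteSpace (S.sieve J) := (S.isClosed_sieve J).completeSpace_coe
  inferInstance

end IndexSpace

/-! ## Sobolev spaces of order `r` with exponent `2` -/

/-- The `i`-th partial derivative. -/
def partialD {d : ℕ} (i : Fin d) (φ : (Fin d → ℝ) → ℝ) : (Fin d → ℝ) → ℝ :=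
  fun x => fderiv ℝ φ x (Pi.single i 1)

/-- The iterated partial derivative `∂^α φ` for a multi-index `α`. -/
def multiD {d : ℕ} (α : Fin d → ℕ) (φ : (Fin d → ℝ) → ℝ) : (Fin d → ℝ) → ℝ :=
  (List.finRange d).foldr (fun i g => (partialD i)^[α i] g) φ

/-- `g` is a weak derivative of order `α` of `f` on the open set `U`, with `g` in `L²(U)`. -/
def IsWeakDerivL2 {d : ℕ} (U : Set (Fin d → ℝ)) (α : Fin d → ℕ) (f g : (Fin d → ℝ) → ℝ) : Prop :=
  MemLp g 2 (volume.restrict U) ∧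
    ∀ φ : (Fin d → ℝ) → ℝ, ContDiff ℝ (⊤ : ℕ∞) φ → HasCompactSupport φ → tsupport φ ⊆ U →
      ∫ x in U, f x * multiD α φ x = (-1) ^ (∑ i, α i) * ∫ x in U, g x * φ x

/-- `f` belongs to the Sobolev space `W^{r,2}(U)`. -/
def MemW2 {d : ℕ} (U : Set (Fin d → ℝ)) (r : ℕ) (f : (Fin d → ℝ) → ℝ) : Prop :=
  MemLp f 2 (volume.restrict U) ∧
    ∀ α : Fin d → ℕ, ∑ i, α i ≤ r → ∃ g, IsWeakDerivL2 U α f g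

open Classical in
/-- The weak derivative of order `α` of `f` on `U` (unique up to null sets; `0` if there is
none). -/
def weakDeriv {d : ℕ} (U : Set (Fin d → ℝ)) (α : Fin d → ℕ) (f : (Fin d → ℝ) → ℝ) :
    (Fin d → ℝ) → ℝ :=
  if h : ∃ g, IsWeakDerivL2 U α f g then h.choose else 0

/-- The Sobolev norm: the square root of the sum of `‖D^α f‖²` (norms in `L²(U)`) over all
multi-indices `α` of order at most `r`. -/
def normW2 {d : ℕ} (U : Set (Fin d → ℝ)) (r : ℕ) (f : (Fin d → ℝ) → ℝ) : ℝ :=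
  Real.sqrt (∑ k ∈ Finset.range (r + 1), ∑ α ∈ Finset.piAntidiag (Finset.univ : Finset (Fin d)) k,
    (eLpNorm (weakDeriv U α f) 2 (volume.restrict U)).toReal ^ 2)

/-! ## The assumptions -/

namespace IndexSpace

variable {d m : ℕ}

/-- Regularity of the program: the point `sstar` belongs to `H_{m+1}` (so that it has positive
mass), `a(t)(sstar) = c(sstar) = 1` for every `t`, and the dual problem is feasible. Continuity
of `a` and `b` is part of the type `Param`. -/
structure Regular (S : IndexSpace d m) {𝒯 : Set (Fin d → ℝ)} (θ : Param 𝒯 S.X) : Prop where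
  exists_atom : ∃ sstar ∈ S.atoms, (∀ t : 𝒯, θ.a t sstar = 1) ∧ θ.c sstar = 1
  feasible : θ.DualFeasible

/-- Sobolev smoothness of order `r` with bound `C`: on the interior of every cube, `c` and all
`a(t)` lie in `W^{r,2}` with norm at most `C`. -/
structure Smooth (S : IndexSpace d m) {𝒯 : Set (Fin d → ℝ)} (θ : Param 𝒯 S.X) (r : ℕ) (C : ℝ) :
    Prop where
  c_mem : ∀ j, MemW2 (interior (S.cube j)) r θ.c ∧ normW2 (interior (S.cube j)) r θ.c ≤ C
  a_mem : ∀ (t : 𝒯) (j), MemW2 (interior (S.cube j)) r (θ.a t) ∧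
    normW2 (interior (S.cube j)) r (θ.a t) ≤ C

end IndexSpace

end

/-!
The two parts have independent proofs.

*Perturbation bound.* On the ball of radius `γ` the penalty function changes by at most
`γ (δᵃ + δᶜ) + δᵇ` when the parameter changes, and by at most `γ δᵖ` when its argument is
projected onto the sieve space (`Param.penalty_le_of_norm_le`, `Param.penalty_starProjection_le`).
This already gives the upper bound, where `β` cancels. The lower bound needs in addition that `β`
is a lower bound of the penalty function on all of `X`
(`IndexSpace.Regular.nonempty_and_le_penalty`). For the linear program, a violation `M` of the
constraints at `x` is repaired by adding `M` times the indicator of the atom `s*`, which is a vector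
of `X` and costs exactly `M`. For the transport problem this is weak duality; strong duality is not
needed. The values at `s*` also show that a dual feasible measure is a probability measure.

*Projection error.* Products `E_n` of Legendre polynomials of degrees `n₁, …, n_d` form an
orthogonal basis of `L²` of a cube (`LegendreSieve.legendreHilbertBasis`). By the Sturm–Liouville
equation

  `((1 - u²)ˢ⁺¹ L⁽ˢ⁺¹⁾)' = -(n - s)(n + s + 1) (1 - u²)ˢ L⁽ˢ⁾`,   `L = L_n`,

and repeated integration by parts, `⟨f, E_n⟩` is the product over `s < r` of the inverse
eigenvalues `((nᵢ - s)(nᵢ + s + 1))⁻¹` times `⟨∂ᵢʳ f, (1 - xᵢ²)ʳ ∂ᵢʳ E_n⟩`. The functions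
`(1 - xᵢ²)^(r/2) ∂ᵢʳ E_n` are again orthogonal, with squared norms that are multiplied by the
same eigenvalues, so that Bessel's inequality bounds the sum of the squared coefficients with
`nᵢ > κ / d` by a constant times `κ⁻²ʳ ‖∂ᵢʳ f‖²` (`LegendreSieve.sum_inner_legendreLp_sq_le`). Every
index of total degree above `κ` has such a component. Weak derivatives are only tested against
functions with compact support in the open cube; the factors `1 - xᵢ²` make a cutoff argument
possible, and in the coordinates that are not differentiated a bounded cutoff is enough
(`LegendreSieve.integral_mul_tens_derivative`).
-/

noncomputable section

/-! ### Perturbation of the penalized problem -/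

namespace Param

variable {d : ℕ} {𝒯 : Set (Fin d → ℝ)} {X : Type} [NormedAddCommGroup X]

theorem norm_sub_le_errA [CompactSpace 𝒯] (θ θhat : Param 𝒯 X) (t : 𝒯) :
    ‖θhat.a t - θ.a t‖ ≤ θ.errA θhat :=
  le_ciSup (f := fun t : 𝒯 => ‖θhat.a t - θ.a t‖)
    (isCompact_range (θhat.a.continuous.sub θ.a.continuous).norm).bddAbove t

theorem abs_sub_le_errB [CompactSpace 𝒯] (θ θhat : Param 𝒯 X) (t : 𝒯) :
    |θhat.b t - θ.b t| ≤ θ.errB θhat :=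
  le_ciSup (f := fun t : 𝒯 => |θhat.b t - θ.b t|)
    (isCompact_range (θhat.b.continuous.sub θ.b.continuous).abs).bddAbove t

theorem errA_comm (θ θhat : Param 𝒯 X) : θhat.errA θ = θ.errA θhat :=
  iSup_congr fun _ => norm_sub_rev _ _

theorem errB_comm (θ θhat : Param 𝒯 X) : θhat.errB θ = θ.errB θhat :=
  iSup_congr fun _ => abs_sub_comm _ _

theorem errC_comm (θ θhat : Param 𝒯 X) : θhat.errC θ = θ.errC θhat :=
  norm_sub_rev _ _

variable [InnerProductSpace ℝ X]

theorem continuous_slack (θ : Param 𝒯 X) (x : X) :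
    Continuous fun t : 𝒯 => θ.b t - inner ℝ (θ.a t) x :=
  θ.b.continuous.sub (θ.a.continuous.inner continuous_const)

theorem slack_le_iSup [CompactSpace 𝒯] (θ : Param 𝒯 X) (x : X) (t : 𝒯) :
    θ.b t - inner ℝ (θ.a t) x ≤ ⨆ t : 𝒯, (θ.b t - inner ℝ (θ.a t) x) :=
  le_ciSup (isCompact_range (θ.continuous_slack x)).bddAbove t

/-- The penalty function at one point is controlled by the penalty function of another parameter
at another point, once objective and slacks are compared. -/
theorem penalty_le_penalty_add [CompactSpace 𝒯] [Nonempty 𝒯] {θ₁ θ₂ : Param 𝒯 X} {x y : X}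
    {ε δ : ℝ} (hδ : 0 ≤ δ) (hc : inner ℝ θ₁.c x ≤ inner ℝ θ₂.c y + ε)
    (hs : ∀ t, θ₁.b t - inner ℝ (θ₁.a t) x ≤ θ₂.b t - inner ℝ (θ₂.a t) y + δ) :
    θ₁.penalty x ≤ θ₂.penalty y + (ε + δ) := by
  have h : max (⨆ t : 𝒯, (θ₁.b t - inner ℝ (θ₁.a t) x)) 0
      ≤ max (⨆ t : 𝒯, (θ₂.b t - inner ℝ (θ₂.a t) y)) 0 + δ := by
    refine max_le (ciSup_le fun t => ?_) (by positivity)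
    have := θ₂.slack_le_iSup y t
    linarith [hs t, le_max_left (⨆ t : 𝒯, (θ₂.b t - inner ℝ (θ₂.a t) y)) 0]
  unfold penalty
  linarith

/-- On the ball of radius `γ` the penalty function depends on the parameter in a Lipschitz
way. -/
theorem penalty_le_of_norm_le [CompactSpace 𝒯] [Nonempty 𝒯] (θ θhat : Param 𝒯 X) {γ : ℝ} {x : X}
    (hx : ‖x‖ ≤ γ) :
    θhat.penalty x ≤ θ.penalty x + (γ * (θ.errA θhat + θ.errC θhat) + θ.errB θhat) := by
  obtain ⟨t₀⟩ := ‹Nonempty 𝒯›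
  have hγ : 0 ≤ γ := (norm_nonneg x).trans hx
  have hA : 0 ≤ θ.errA θhat := (norm_nonneg _).trans (θ.norm_sub_le_errA θhat t₀)
  have hB : 0 ≤ θ.errB θhat := (abs_nonneg _).trans (θ.abs_sub_le_errB θhat t₀)
  have key : θhat.penalty x
      ≤ θ.penalty x + (γ * θ.errC θhat + (γ * θ.errA θhat + θ.errB θhat)) := by
    have : Nonempty 𝒯 := ⟨t₀⟩
    refine penalty_le_penalty_add (by positivity) ?_ fun t => ?_
    · have h1 : inner ℝ θhat.c x - inner ℝ θ.c x ≤ ‖θhat.c - θ.c‖ * ‖x‖ := by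
        rw [← inner_sub_left]
        exact real_inner_le_norm _ _
      have h2 : ‖θhat.c - θ.c‖ * ‖x‖ ≤ ‖θhat.c - θ.c‖ * γ := by gcongr
      unfold errC
      linarith
    · have h1 : inner ℝ (θ.a t) x - inner ℝ (θhat.a t) x ≤ ‖θ.a t - θhat.a t‖ * ‖x‖ := by
        rw [← inner_sub_left]
        exact real_inner_le_norm _ _
      rw [norm_sub_rev] at h1
      have h2 : ‖θhat.a t - θ.a t‖ * ‖x‖ ≤ θ.errA θhat * γ :=
        mul_le_mul (θ.norm_sub_le_errA θhat t) hx (norm_nonneg _) hA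
      have h3 := (le_abs_self _).trans (θ.abs_sub_le_errB θhat t)
      linarith
  linarith

/-- Projecting the argument onto `V` costs at most `γ` times the projection error. -/
theorem penalty_starProjection_le [CompactSpace 𝒯] [Nonempty 𝒯] (θ : Param 𝒯 X)
    (V : Submodule ℝ X) [V.HasOrthogonalProjection] {γ : ℝ} {x : X} (hx : ‖x‖ ≤ γ) :
    θ.penalty (V.starProjection x) ≤ θ.penalty x + γ * θ.projError V := by
  have hγ : 0 ≤ γ := (norm_nonneg x).trans hx
  have hinner : ∀ v : X, |inner ℝ v (V.starProjection x) - inner ℝ v x|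
      ≤ γ * ‖v - V.starProjection v‖ := fun v => by
    rw [← V.inner_starProjection_left_eq_right, ← inner_sub_left, mul_comm, norm_sub_rev]
    exact (abs_real_inner_le_norm _ _).trans (by gcongr)
  have hle : ∀ t : 𝒯, ‖θ.a t - V.starProjection (θ.a t)‖
      ≤ ⨆ t : 𝒯, ‖θ.a t - V.starProjection (θ.a t)‖ := fun t =>
    le_ciSup (f := fun t : 𝒯 => ‖θ.a t - V.starProjection (θ.a t)‖)
      (isCompact_range (θ.a.continuous.sub
        (V.starProjection.continuous.comp θ.a.continuous)).norm).bddAbove t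
  have h0 : 0 ≤ ⨆ t : 𝒯, ‖θ.a t - V.starProjection (θ.a t)‖ :=
    Real.iSup_nonneg fun _ => norm_nonneg _
  have := penalty_le_penalty_add (θ₁ := θ) (θ₂ := θ) (x := V.starProjection x) (y := x)
    (ε := γ * ‖θ.c - V.starProjection θ.c‖)
    (δ := γ * ⨆ t : 𝒯, ‖θ.a t - V.starProjection (θ.a t)‖) (by positivity)
    (by linarith [(abs_le.1 (hinner θ.c)).2])
    (fun t => by
      have h1 := (abs_le.1 (hinner (θ.a t))).1
      have h2 := mul_le_mul_of_nonneg_left (hle t) hγ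
      linarith)
  unfold projError
  linarith

theorem bddBelow_penalty (θ : Param 𝒯 X) {γ : ℝ} {s : Set X} (hs : ∀ x ∈ s, ‖x‖ ≤ γ) :
    BddBelow (θ.penalty '' s) := by
  refine ⟨-(‖θ.c‖ * γ), ?_⟩
  rintro _ ⟨x, hx, rfl⟩
  have h1 := (abs_le.1 (abs_real_inner_le_norm θ.c x)).1
  have h2 : ‖θ.c‖ * ‖x‖ ≤ ‖θ.c‖ * γ := by gcongr; exact hs x hx
  unfold penalty
  linarith [le_max_right (⨆ t : 𝒯, (θ.b t - inner ℝ (θ.a t) x)) 0]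

theorem subspaceBallValue_le_ballValue_add [CompactSpace 𝒯] [Nonempty 𝒯] (θ θhat : Param 𝒯 X)
    (V : Submodule ℝ X) [V.HasOrthogonalProjection] {γ : ℝ} (hγ : 0 ≤ γ) :
    θhat.subspaceBallValue V γ ≤ θ.ballValue γ +
      (γ * (θ.errA θhat + θ.errC θhat + θ.projError V) + θ.errB θhat) := by
  rw [← sub_le_iff_le_add]
  refine le_csInf ⟨_, 0, by simpa using hγ, rfl⟩ ?_
  rintro _ ⟨x, hx, rfl⟩
  have hp : ‖V.starProjection x‖ ≤ γ := (V.norm_starProjection_apply_le x).trans hx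
  have h1 : θhat.subspaceBallValue V γ ≤ θhat.penalty (V.starProjection x) :=
    csInf_le (θhat.bddBelow_penalty fun x hx => hx.1)
      ⟨_, ⟨hp, V.starProjection_apply_mem x⟩, rfl⟩
  have h2 := θ.penalty_le_of_norm_le θhat hp
  have h3 := θ.penalty_starProjection_le V hx
  linarith

/-- A lower bound for the penalty function of `θ` on all of `X` perturbs to a lower bound for
the penalized problem of `θhat`. -/
theorem le_subspaceBallValue_of_le_penalty [CompactSpace 𝒯] [Nonempty 𝒯] (θ θhat : Param 𝒯 X)
    (V : Submodule ℝ X) {γ : ℝ} (hγ : 0 ≤ γ) {β : ℝ} (hβ : ∀ x, β ≤ θ.penalty x) :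
    β - (γ * (θ.errA θhat + θ.errC θhat) + θ.errB θhat) ≤ θhat.subspaceBallValue V γ := by
  refine le_csInf ⟨_, 0, ⟨by simpa using hγ, V.zero_mem⟩, rfl⟩ ?_
  rintro _ ⟨x, hx, rfl⟩
  have h := θhat.penalty_le_of_norm_le θ hx.1
  rw [errA_comm, errB_comm, errC_comm] at h
  linarith [hβ x]

/-- Weak duality for the generalized optimal transport problem, with the penalty term in place
of the constraints: the total mass one of `P` absorbs the violation of the constraints. -/
theorem integral_le_penalty [CompleteSpace X] [CompactSpace 𝒯] (θ : Param 𝒯 X) (P : Measure 𝒯)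
    [IsProbabilityMeasure P] (hP : ∫ t, θ.a t ∂P = θ.c) (x : X) :
    ∫ t, θ.b t ∂P ≤ θ.penalty x := by
  have ha : Integrable (fun t => θ.a t) P :=
    θ.a.continuous.integrable_of_hasCompactSupport (HasCompactSupport.of_compactSpace _)
  have hb : Integrable (fun t => θ.b t) P :=
    θ.b.continuous.integrable_of_hasCompactSupport (HasCompactSupport.of_compactSpace _)
  have hax : Integrable (fun t => inner ℝ (θ.a t) x) P := ha.inner_const x
  have hc : inner ℝ θ.c x = ∫ t, inner ℝ (θ.a t) x ∂P := by
    rw [← hP, real_inner_comm, ← integral_inner ha]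
    simp_rw [real_inner_comm]
  have h : ∫ t, (θ.b t - inner ℝ (θ.a t) x) ∂P
      ≤ ∫ _, max (⨆ t : 𝒯, (θ.b t - inner ℝ (θ.a t) x)) 0 ∂P :=
    integral_mono (hb.sub hax) (integrable_const _) fun t =>
      (θ.slack_le_iSup x t).trans (le_max_left _ _)
  rw [integral_sub hb hax, integral_const, probReal_univ, one_smul] at h
  unfold penalty
  linarith

end Param

namespace IndexSpace

variable {d m : ℕ} {𝒯 : Set (Fin d → ℝ)} {S : IndexSpace d m}

theorem nu_singleton (hd : 1 ≤ d) {s : Fin d → ℝ} (hs : s ∈ S.atoms) : S.nu {s} = 1 := by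
  have : Nonempty (Fin d) := ⟨⟨0, hd⟩⟩
  simp only [nu, Measure.coe_add, Measure.coe_finsetSum, Pi.add_apply, Finset.sum_apply]
  rw [Finset.sum_eq_zero fun j _ => ?_, Finset.sum_eq_single_of_mem s hs fun t _ ht => ?_]
  · simp
  · simp [ht]
  · exact le_antisymm ((Measure.restrict_apply_le _ _).trans (by simp)) zero_le

/-- Evaluation at an atom is a continuous linear functional on `X`: it is represented by the
indicator function of the atom. -/
theorem exists_inner_eq_apply (hd : 1 ≤ d) {s : Fin d → ℝ} (hs : s ∈ S.atoms) :
    ∃ e : S.X, ∀ f : S.X, inner ℝ f e = f s := by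
  refine ⟨indicatorConstLp 2 (measurableSet_singleton s)
    (by rw [nu_singleton hd hs]; simp) (1 : ℝ), fun f => ?_⟩
  rw [real_inner_comm, L2.inner_indicatorConstLp_one, Measure.restrict_singleton,
    nu_singleton hd hs, one_smul, integral_dirac]

/-- A measure that is feasible for the dual problem is a probability measure, by the moment
restriction at an atom where `a` and `c` are equal to one. -/
theorem isProbabilityMeasure_of_integral_eq [CompactSpace 𝒯] {θ : Param 𝒯 S.X} {e : S.X}
    (ha : ∀ t, inner ℝ (θ.a t) e = (1 : ℝ)) (hc : inner ℝ θ.c e = (1 : ℝ)) (lam : Measure 𝒯)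
    [IsFiniteMeasure lam] (h : ∫ t, θ.a t ∂lam = θ.c) : IsProbabilityMeasure lam := by
  have hint : Integrable (fun t => θ.a t) lam :=
    θ.a.continuous.integrable_of_hasCompactSupport (HasCompactSupport.of_compactSpace _)
  have h1 : ∫ t, inner ℝ (θ.a t) e ∂lam = 1 := by
    simp_rw [fun t => real_inner_comm e (θ.a t)]
    rw [integral_inner hint, h, real_inner_comm, hc]
  simp only [ha, integral_const, smul_eq_mul, mul_one] at h1
  exact isProbabilityMeasure_iff_real.2 h1

/-- The penalty parameter one makes the penalty exact: both optimal values are lower bounds of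
the penalty function. -/
theorem Regular.nonempty_and_le_penalty (hd : 1 ≤ d) (h𝒯 : IsCompact 𝒯) {θ : Param 𝒯 S.X}
    (hθ : S.Regular θ) {β : ℝ} (hβ : β = θ.primalValue ∨ β = θ.gotValue) :
    Nonempty 𝒯 ∧ ∀ x, β ≤ θ.penalty x := by
  have : CompactSpace 𝒯 := isCompact_iff_compactSpace.1 h𝒯
  obtain ⟨s, hs, has, hcs⟩ := hθ.exists_atom
  obtain ⟨e, he⟩ := exists_inner_eq_apply hd hs
  obtain ⟨lam, hfin, hlam⟩ := hθ.feasible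
  have hae : ∀ t, inner ℝ (θ.a t) e = (1 : ℝ) := fun t => by rw [he, has]
  have hce : inner ℝ θ.c e = (1 : ℝ) := by rw [he, hcs]
  have hprob := isProbabilityMeasure_of_integral_eq hae hce lam hlam
  refine ⟨nonempty_of_isProbabilityMeasure lam, fun x => ?_⟩
  rcases hβ with rfl | rfl
  · set M : ℝ := max (⨆ t : 𝒯, (θ.b t - inner ℝ (θ.a t) x)) 0 with hM
    refine csInf_le ⟨∫ t, θ.b t ∂lam, ?_⟩ ⟨x + M • e, fun t => ?_, ?_⟩
    · rintro _ ⟨y, hy, rfl⟩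
      have := nonempty_of_isProbabilityMeasure lam
      have h1 := θ.integral_le_penalty lam hlam y
      have h2 : (⨆ t : 𝒯, (θ.b t - inner ℝ (θ.a t) y)) ≤ 0 :=
        ciSup_le fun t => by linarith [hy t]
      rwa [Param.penalty, max_eq_right h2, add_zero] at h1
    · rw [inner_add_right, inner_smul_right, hae]
      linarith [θ.slack_le_iSup x t, le_max_left (⨆ t : 𝒯, (θ.b t - inner ℝ (θ.a t) x)) 0]
    · rw [inner_add_right, inner_smul_right, hce, mul_one, Param.penalty]
  · refine csSup_le ⟨_, lam, hprob, hlam, rfl⟩ ?_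
    rintro _ ⟨P, hP, hPc, rfl⟩
    exact θ.integral_le_penalty P hPc x

end IndexSpace

/-! ### Legendre polynomials in one variable -/

namespace LegendreSieve

open Polynomial

/-- The weight `1 - X²`, whose powers are the weights of the derivatives of the Legendre
polynomials. -/
def weight : ℝ[X] := 1 - X ^ 2

/-- The Legendre polynomial of degree `n`, by the formula of Rodrigues and without a normalizing
factor. -/
def legendre (n : ℕ) : ℝ[X] := derivative^[n] ((X ^ 2 - 1) ^ n)

theorem derivative_weight : derivative weight = -2 * X := by
  simp [weight]
  ring

/-- The differential equation for all derivatives of `(X² - 1)ⁿ`. -/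
theorem weight_mul_iterate_derivative (n k : ℕ) :
    weight * derivative^[k + 2] ((X ^ 2 - 1) ^ n : ℝ[X])
      + C (2 * ((n : ℝ) - 1 - k)) * X * derivative^[k + 1] ((X ^ 2 - 1) ^ n)
      + C ((2 * (n : ℝ) - k) * (k + 1)) * derivative^[k] ((X ^ 2 - 1) ^ n) = 0 := by
  have h0 : weight * derivative ((X ^ 2 - 1) ^ n : ℝ[X])
      + C (2 * (n : ℝ)) * X * (X ^ 2 - 1) ^ n = 0 := by
    rcases n with _ | n
    · simp
    · rw [derivative_pow]
      have h2 : (C 2 : ℝ[X]) = 2 := map_ofNat C 2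
      simp [weight, h2]
      ring
  induction k with
  | zero =>
    have h1 := congrArg derivative h0
    simp only [derivative_add, derivative_mul, derivative_weight, derivative_C, derivative_X,
      derivative_zero] at h1
    simp only [Function.iterate_succ_apply', Function.iterate_zero_apply, map_mul, map_sub,
      map_natCast, map_one, Nat.cast_zero, sub_zero, zero_add, map_ofNat,
      mul_one] at h1 ⊢
    linear_combination h1
  | succ k ih =>
    have h1 := congrArg derivative ih
    simp only [derivative_add, derivative_mul, derivative_weight, derivative_C, derivative_X,
      derivative_zero, ← Function.iterate_succ_apply' (⇑derivative)] at h1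
    simp only [map_mul, map_sub, map_add, map_natCast, map_one, Nat.cast_succ, map_ofNat,
      add_assoc, Nat.reduceAdd] at h1 ⊢
    linear_combination h1

/-- The Sturm–Liouville eigenvalue `(n - s)(n + s + 1)` of the `s`-th derivative of the `n`-th
Legendre polynomial. -/
def eig (n s : ℕ) : ℝ := ((n : ℝ) - s) * (n + s + 1)

/-- The Sturm–Liouville equation of the derivatives of the Legendre polynomials. -/
theorem derivative_weight_pow_mul (n s : ℕ) :
    derivative (weight ^ (s + 1) * derivative^[s + 1] (legendre n))
      = -(C (eig n s) * (weight ^ s * derivative^[s] (legendre n))) := by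
  have h := weight_mul_iterate_derivative n (s + n)
  have e : ∀ k, derivative^[k + n] ((X ^ 2 - 1) ^ n : ℝ[X]) = derivative^[k] (legendre n) :=
    fun k => Function.iterate_add_apply _ _ _ _
  rw [show s + n + 2 = (s + 2) + n by ring, show s + n + 1 = (s + 1) + n by ring, e, e, e] at h
  rw [derivative_mul, derivative_pow, derivative_weight,
    ← Function.iterate_succ_apply' (⇑derivative)]
  simp only [eig, map_mul, map_sub, map_add, map_natCast, map_one, Nat.cast_add, map_ofNat,
    Nat.add_sub_cancel, Nat.succ_eq_add_one, add_assoc, Nat.reduceAdd, Nat.cast_one] at h ⊢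
  linear_combination weight ^ s * h

theorem natDegree_X_sq_sub_one_pow (n : ℕ) : ((X ^ 2 - 1 : ℝ[X]) ^ n).natDegree = n + n := by
  rw [natDegree_pow, show (X ^ 2 - 1 : ℝ[X]) = X ^ 2 - C 1 by simp, natDegree_X_pow_sub_C]
  ring

theorem natDegree_legendre_le (n : ℕ) : (legendre n).natDegree ≤ n := by
  refine (natDegree_iterate_derivative _ _).trans ?_
  rw [natDegree_X_sq_sub_one_pow]
  omega

theorem degree_legendre (n : ℕ) : (legendre n).degree = n := by
  refine degree_eq_of_le_of_coeff_ne_zero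
    (natDegree_le_iff_degree_le.1 (natDegree_legendre_le n)) ?_
  have hm : ((X ^ 2 - 1 : ℝ[X]) ^ n).coeff (n + n) = 1 := by
    rw [← natDegree_X_sq_sub_one_pow]
    have : (X ^ 2 - 1 : ℝ[X]).Monic := by
      rw [show (X ^ 2 - 1 : ℝ[X]) = X ^ 2 - C 1 by simp]
      exact monic_X_pow_sub_C _ two_ne_zero
    exact this.pow n
  rw [legendre, coeff_iterate_derivative, hm, nsmul_eq_mul, mul_one, Nat.cast_ne_zero]
  exact (Nat.descFactorial_pos.2 (by omega)).ne'

/-- The Legendre polynomials as a basis of the space of all polynomials. -/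
def legendreBasis : Module.Basis ℕ ℝ ℝ[X] :=
  Polynomial.Sequence.basis ⟨legendre, degree_legendre⟩ fun i =>
    (isUnit_iff_ne_zero.2 (leadingCoeff_ne_zero.2
      (Polynomial.Sequence.ne_zero ⟨legendre, degree_legendre⟩ i)))

theorem legendreBasis_apply (n : ℕ) : legendreBasis n = legendre n :=
  Polynomial.Sequence.basis_eq_self _ _ _

/-- The integral over `[-1, 1]` of the product of `(1 - x²)ˢ` and of the `s`-th derivatives of
two Legendre polynomials. -/
def pairing (s n k : ℕ) : ℝ :=
  ∫ x in (-1 : ℝ)..1,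
    (weight ^ s * derivative^[s] (legendre n) * derivative^[s] (legendre k)).eval x

theorem intervalIntegrable_eval (p : ℝ[X]) (a b : ℝ) :
    IntervalIntegrable (fun x => p.eval x) volume a b :=
  p.continuous.intervalIntegrable a b

/-- Integration by parts, with boundary terms that vanish because of the weight. -/
theorem integral_derivative_mul_of_weight (p q : ℝ[X]) :
    ∫ x in (-1 : ℝ)..1, (derivative (weight * p) * q).eval x
      = -∫ x in (-1 : ℝ)..1, (weight * p * derivative q).eval x := by
  have h : ∫ x in (-1 : ℝ)..1, (derivative (weight * p * q)).eval x = 0 := by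
    rw [intervalIntegral.integral_eq_sub_of_hasDerivAt
      (fun x _ => (weight * p * q).hasDerivAt x) (intervalIntegrable_eval _ _ _)]
    simp [weight]
  rw [derivative_mul, ← add_eq_zero_iff_eq_neg,
    ← intervalIntegral.integral_add (intervalIntegrable_eval _ _ _) (intervalIntegrable_eval _ _ _)]
  · simpa using h

theorem pairing_succ (s n k : ℕ) : pairing (s + 1) n k = eig n s * pairing s n k := by
  have h := integral_derivative_mul_of_weight (weight ^ s * derivative^[s + 1] (legendre n))
    (derivative^[s] (legendre k))
  rw [← mul_assoc, ← pow_succ', derivative_weight_pow_mul,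
    ← Function.iterate_succ_apply' (⇑derivative)] at h
  rw [pairing, pairing, ← neg_inj, ← h, ← intervalIntegral.integral_const_mul,
    ← intervalIntegral.integral_neg]
  congr 1
  ext x
  simp
  ring

theorem pairing_eq_prod (s n k : ℕ) :
    pairing s n k = (∏ i ∈ Finset.range s, eig n i) * pairing 0 n k := by
  induction s with
  | zero => simp
  | succ s ih => rw [pairing_succ, ih, Finset.prod_range_succ]; ring

theorem pairing_comm (s n k : ℕ) : pairing s n k = pairing s k n := by
  unfold pairing
  congr 1
  ext x
  simp
  ring

/-- Legendre polynomials of different degrees are orthogonal, as eigenvectors of a symmetric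
operator with different eigenvalues. -/
theorem pairing_zero_of_ne {n k : ℕ} (h : n ≠ k) : pairing 0 n k = 0 := by
  have h1 := pairing_succ 0 n k
  have h2 := pairing_succ 0 k n
  rw [pairing_comm, h2, pairing_comm 0 k n] at h1
  have h3 : eig k 0 - eig n 0 ≠ 0 := by
    have : eig k 0 - eig n 0 = ((k : ℝ) - n) * (k + n + 1) := by
      simp only [eig, Nat.cast_zero]
      ring
    rw [this]
    exact mul_ne_zero (sub_ne_zero.2 (Nat.cast_injective.ne h.symm)) (by positivity)
  refine (mul_eq_zero.1 (?_ : (eig k 0 - eig n 0) * pairing 0 n k = 0)).resolve_left h3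
  linear_combination h1

theorem pairing_of_ne {n k : ℕ} (s : ℕ) (h : n ≠ k) : pairing s n k = 0 := by
  rw [pairing_eq_prod, pairing_zero_of_ne h, mul_zero]

theorem pairing_self_pos (n : ℕ) : 0 < pairing 0 n n := by
  have hne : legendre n ≠ 0 := fun h => by simpa [h] using degree_legendre n
  have hcont : Continuous fun x : ℝ =>
      (weight ^ 0 * derivative^[0] (legendre n) * derivative^[0] (legendre n)).eval x :=
    Polynomial.continuous _
  have hnn : ∀ x : ℝ, 0 ≤
      (weight ^ 0 * derivative^[0] (legendre n) * derivative^[0] (legendre n)).eval x := fun x => by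
    simpa using mul_self_nonneg _
  -- a nonzero polynomial does not vanish on all of the interval
  obtain ⟨x, hx, hx0⟩ : ∃ x ∈ Set.Icc (-1 : ℝ) 1, (legendre n).eval x ≠ 0 := by
    by_contra! hall
    exact hne (Polynomial.eq_zero_of_infinite_isRoot _
      ((Set.Icc_infinite (by norm_num : (-1 : ℝ) < 1)).mono hall))
  exact intervalIntegral.integral_pos (by norm_num) hcont.continuousOn (fun x _ => hnn x)
    ⟨x, hx, by simpa using mul_self_pos.2 hx0⟩

/-- The eigenvalues grow quadratically in the degree, for a bounded number of derivatives. -/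
theorem le_prod_eig {n r : ℕ} (h : 2 * r ≤ n) :
    ((n : ℝ) / 2) ^ (2 * r) ≤ ∏ s ∈ Finset.range r, eig n s := by
  have hs : ∀ s ∈ Finset.range r, ((n : ℝ) / 2) ^ 2 ≤ eig n s := fun s hs => by
    have h1 : (s : ℝ) + 1 ≤ r := by exact_mod_cast Finset.mem_range.1 hs
    have h2 : 2 * (r : ℝ) ≤ n := by exact_mod_cast h
    have h3 : (0 : ℝ) ≤ n := n.cast_nonneg
    rw [sq, eig]
    exact mul_le_mul (by linarith) (by linarith) (by linarith) (by linarith)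
  calc ((n : ℝ) / 2) ^ (2 * r) = ∏ s ∈ Finset.range r, ((n : ℝ) / 2) ^ 2 := by
        rw [Finset.prod_const, Finset.card_range, pow_mul]
    _ ≤ _ := Finset.prod_le_prod (fun _ _ => sq_nonneg _) hs

end LegendreSieve

/-! ### Integration by parts against polynomials -/

namespace LegendreSieve

open Polynomial Filter Topology

/-- A smooth cutoff with compact support in `(-1, 1)` that increases to one there as `k` grows. -/
def bump (k : ℕ) (u : ℝ) : ℝ := Real.smoothTransition (k * (1 - u ^ 2) - 1)

/-- The polynomial `p`, cut off near the endpoints of `[-1, 1]`. -/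
def cutPoly (k : ℕ) (p : ℝ[X]) (u : ℝ) : ℝ := bump k u * p.eval u

theorem contDiff_bump (k : ℕ) : ContDiff ℝ (⊤ : ℕ∞) (bump k) :=
  Real.smoothTransition.contDiff.comp (by fun_prop)

theorem contDiff_cutPoly (k : ℕ) (p : ℝ[X]) : ContDiff ℝ (⊤ : ℕ∞) (cutPoly k p) :=
  (contDiff_bump k).mul (by simpa using p.contDiff_aeval (𝕜 := ℝ) (⊤ : ℕ∞))

theorem eventually_two_lt_mul {u : ℝ} (hu : u ∈ Set.Ioo (-1 : ℝ) 1) :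
    ∀ᶠ k : ℕ in atTop, 2 < k * (1 - u ^ 2) := by
  have h : 0 < 1 - u ^ 2 := by nlinarith [hu.1, hu.2]
  exact (tendsto_natCast_atTop_atTop.atTop_mul_const h).eventually_gt_atTop 2

theorem tendsto_cutPoly (p : ℝ[X]) {u : ℝ} (hu : u ∈ Set.Ioo (-1 : ℝ) 1) :
    Tendsto (fun k => cutPoly k p u) atTop (𝓝 (p.eval u)) := by
  refine tendsto_const_nhds.congr' ?_
  filter_upwards [eventually_two_lt_mul hu] with k hk
  rw [cutPoly, bump, Real.smoothTransition.one_of_one_le (by linarith), one_mul]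

theorem exists_abs_eval_le (p : ℝ[X]) : ∃ M, ∀ u ∈ Set.Ioo (-1 : ℝ) 1, |p.eval u| ≤ M := by
  obtain ⟨M, hM⟩ := (isCompact_Icc (a := (-1 : ℝ)) (b := 1)).exists_bound_of_continuousOn
    p.continuous.continuousOn
  exact ⟨M, fun u hu => hM u (Set.Ioo_subset_Icc_self hu)⟩

theorem abs_bump_mul_le (k : ℕ) (u y : ℝ) : |bump k u * y| ≤ |y| := by
  rw [abs_mul, bump, abs_of_nonneg (Real.smoothTransition.nonneg _)]
  exact mul_le_of_le_one_left (abs_nonneg y) (Real.smoothTransition.le_one _)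

theorem exists_abs_cutPoly_le (p : ℝ[X]) :
    ∃ M, ∀ k, ∀ u ∈ Set.Ioo (-1 : ℝ) 1, |cutPoly k p u| ≤ M := by
  obtain ⟨M, hM⟩ := exists_abs_eval_le p
  exact ⟨M, fun k u hu => (abs_bump_mul_le k u _).trans (hM u hu)⟩

theorem deriv_smoothTransition_of_one_lt {v : ℝ} (h : 1 < v) :
    deriv Real.smoothTransition v = 0 := by
  have : Real.smoothTransition =ᶠ[𝓝 v] fun _ => (1 : ℝ) := by
    filter_upwards [lt_mem_nhds h] with y hy
    exact Real.smoothTransition.one_of_one_le hy.le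
  rw [this.deriv_eq, deriv_const]

theorem deriv_smoothTransition_of_neg {v : ℝ} (h : v < 0) :
    deriv Real.smoothTransition v = 0 := by
  have : Real.smoothTransition =ᶠ[𝓝 v] fun _ => (0 : ℝ) := by
    filter_upwards [gt_mem_nhds h] with y hy
    exact Real.smoothTransition.zero_of_nonpos hy.le
  rw [this.deriv_eq, deriv_const]

theorem exists_abs_deriv_smoothTransition_le :
    ∃ B, 0 ≤ B ∧ ∀ v, |deriv Real.smoothTransition v * (v + 1)| ≤ B := by
  have hc : Continuous fun v : ℝ => deriv Real.smoothTransition v * (v + 1) :=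
    ((Real.smoothTransition.contDiff (n := 1)).continuous_deriv le_rfl).mul (by fun_prop)
  obtain ⟨B, hB⟩ := (isCompact_Icc (a := (0 : ℝ)) (b := 1)).exists_bound_of_continuousOn
    hc.continuousOn
  have h0 : 0 ≤ B := (norm_nonneg _).trans (hB 0 (by simp))
  refine ⟨B, h0, fun v => ?_⟩
  rcases lt_or_ge v 0 with hv | hv
  · simpa [deriv_smoothTransition_of_neg hv] using h0
  rcases lt_or_ge 1 v with hv' | hv'
  · simpa [deriv_smoothTransition_of_one_lt hv'] using h0
  exact hB v ⟨hv, hv'⟩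

theorem hasDerivAt_bump (k : ℕ) (u : ℝ) :
    HasDerivAt (bump k)
      (deriv Real.smoothTransition (k * (1 - u ^ 2) - 1) * (k * (-(2 * u)))) u := by
  have h1 : HasDerivAt (fun u : ℝ => (k : ℝ) * (1 - u ^ 2) - 1) (k * (-(2 * u))) u := by
    have := ((((hasDerivAt_id u).pow 2).const_sub 1).const_mul (k : ℝ)).sub_const 1
    exact this.congr_deriv (by simp)
  have h2 : HasDerivAt Real.smoothTransition
      (deriv Real.smoothTransition (k * (1 - u ^ 2) - 1)) (k * (1 - u ^ 2) - 1) :=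
    ((Real.smoothTransition.contDiff (n := 1)).differentiable one_ne_zero _).hasDerivAt
  exact h2.comp u h1

theorem deriv_cutPoly (k : ℕ) (p : ℝ[X]) (u : ℝ) :
    deriv (cutPoly k p) u
      = deriv Real.smoothTransition (k * (1 - u ^ 2) - 1) * (k * (-(2 * u))) * p.eval u
        + bump k u * (derivative p).eval u :=
  ((hasDerivAt_bump k u).mul (p.hasDerivAt u)).deriv

theorem tendsto_deriv_cutPoly (p : ℝ[X]) {u : ℝ} (hu : u ∈ Set.Ioo (-1 : ℝ) 1) :
    Tendsto (fun k => deriv (cutPoly k p) u) atTop (𝓝 ((derivative p).eval u)) := by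
  refine tendsto_const_nhds.congr' ?_
  filter_upwards [eventually_two_lt_mul hu] with k hk
  rw [deriv_cutPoly, deriv_smoothTransition_of_one_lt (by linarith), bump,
    Real.smoothTransition.one_of_one_le (by linarith)]
  ring

/-- The steep slope of the cutoff near the endpoints is compensated by the factor `1 - u²`. -/
theorem exists_abs_deriv_cutPoly_le (q : ℝ[X]) :
    ∃ M, ∀ k, ∀ u ∈ Set.Ioo (-1 : ℝ) 1, |deriv (cutPoly k (weight * q)) u| ≤ M := by
  obtain ⟨B, hB0, hB⟩ := exists_abs_deriv_smoothTransition_le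
  obtain ⟨M₁, h1⟩ := exists_abs_eval_le (2 * X * q)
  obtain ⟨M₂, h2⟩ := exists_abs_eval_le (derivative (weight * q))
  refine ⟨B * M₁ + M₂, fun k u hu => ?_⟩
  rw [deriv_cutPoly]
  refine (abs_add_le _ _).trans (add_le_add ?_ ((abs_bump_mul_le k u _).trans (h2 u hu)))
  have : deriv Real.smoothTransition (k * (1 - u ^ 2) - 1) * (k * (-(2 * u)))
        * (weight * q).eval u
      = -((deriv Real.smoothTransition (k * (1 - u ^ 2) - 1) * (k * (1 - u ^ 2) - 1 + 1))
        * (2 * X * q).eval u) := by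
    simp [weight]
    ring
  rw [this, abs_neg, abs_mul]
  exact mul_le_mul (hB _) (h1 u hu) (abs_nonneg _) hB0

variable {d : ℕ}

theorem mem_interior_cubeAt {t₀ : ℝ} {x : Fin d → ℝ} :
    x ∈ interior (cubeAt d t₀) ↔ ∀ j, x j - t₀ ∈ Set.Ioo (-1 : ℝ) 1 := by
  rw [cubeAt, ← Set.pi_univ_Icc, interior_pi_set Set.finite_univ]
  simp only [interior_Icc, Set.mem_pi, Set.mem_univ, true_implies, Set.mem_Ioo]
  refine forall_congr' fun j => ?_
  constructor <;> rintro ⟨h1, h2⟩ <;> constructor <;> linarith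

theorem mem_cubeAt {t₀ : ℝ} {x : Fin d → ℝ} :
    x ∈ cubeAt d t₀ ↔ ∀ j, x j - t₀ ∈ Set.Icc (-1 : ℝ) 1 := by
  rw [cubeAt, ← Set.pi_univ_Icc]
  simp only [Set.mem_pi, Set.mem_univ, true_implies, Set.mem_Icc]
  refine forall_congr' fun j => ?_
  constructor <;> rintro ⟨h1, h2⟩ <;> constructor <;> linarith

theorem restrict_interior_cubeAt (d : ℕ) (t₀ : ℝ) :
    (volume.restrict (interior (cubeAt d t₀)) : Measure (Fin d → ℝ))
      = volume.restrict (cubeAt d t₀) := by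
  refine Measure.restrict_congr_set ?_
  have h := Measure.univ_pi_Ioo_ae_eq_Icc (μ := fun _ : Fin d => (volume : Measure ℝ))
    (f := fun _ => -1 + t₀) (g := fun _ => 1 + t₀)
  rw [cubeAt, ← Set.pi_univ_Icc, interior_pi_set Set.finite_univ]
  simp only [interior_Icc]
  rw [Set.pi_univ_Icc]
  exact h

instance isFiniteMeasure_restrict_cubeAt (d : ℕ) (t₀ : ℝ) :
    IsFiniteMeasure (volume.restrict (cubeAt d t₀) : Measure (Fin d → ℝ)) :=
  ⟨by simpa [cubeAt] using (isCompact_Icc (a := fun _ : Fin d => -1 + t₀)).measure_lt_top⟩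

/-- The partial derivative of a product of functions of one coordinate each. -/
theorem partialD_prod {h : Fin d → ℝ → ℝ} (hh : ∀ j, Differentiable ℝ (h j)) (i : Fin d) :
    partialD i (fun x => ∏ j, h j (x j))
      = fun x => ∏ j, Function.update h i (deriv (h i)) j (x j) := by
  ext x
  have h1 : ∀ j ∈ (Finset.univ : Finset (Fin d)), HasFDerivAt (fun x : Fin d → ℝ => h j (x j))
      (deriv (h j) (x j) • (ContinuousLinearMap.proj j : (Fin d → ℝ) →L[ℝ] ℝ)) x := fun j _ =>
    (hh j (x j)).hasDerivAt.comp_hasFDerivAt x 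
      (ContinuousLinearMap.proj (R := ℝ) (φ := fun _ : Fin d => ℝ) j).hasFDerivAt
  rw [partialD, (HasFDerivAt.finsetProd h1).fderiv, _root_.sum_apply,
    Finset.sum_eq_single_of_mem i (Finset.mem_univ i) fun j _ hj => by simp [hj]]
  rw [← Finset.mul_prod_erase _ _ (Finset.mem_univ i), mul_comm]
  simp only [_root_.smul_apply, ContinuousLinearMap.proj_apply, Pi.single_eq_same,
    smul_eq_mul, mul_one, Function.update_self]
  congr 1
  exact Finset.prod_congr rfl fun j hj => by rw [Function.update_of_ne (Finset.ne_of_mem_erase hj)]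

theorem multiD_single (i : Fin d) (s : ℕ) (φ : (Fin d → ℝ) → ℝ) :
    multiD (Pi.single i s) φ = (partialD i)^[s] φ := by
  have h : ∀ l : List (Fin d), l.Nodup →
      l.foldr (fun j g => (partialD j)^[(Pi.single i s : Fin d → ℕ) j] g) φ
        = if i ∈ l then (partialD i)^[s] φ else φ := by
    intro l
    induction l with
    | nil => simp
    | cons j l ih =>
      intro hl
      rw [List.nodup_cons] at hl
      rw [List.foldr_cons, ih hl.2]
      by_cases hj : j = i
      · subst hj
        simp [hl.1]
      · simp [hj, Ne.symm hj]
  rw [multiD, h _ (List.nodup_finRange d), if_pos (List.mem_finRange i)]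

theorem contDiff_partialD {φ : (Fin d → ℝ) → ℝ} (h : ContDiff ℝ (⊤ : ℕ∞) φ) (i : Fin d) :
    ContDiff ℝ (⊤ : ℕ∞) (partialD i φ) :=
  (h.fderiv_right (m := (⊤ : ℕ∞)) (by simp)).clm_apply contDiff_const

theorem tsupport_partialD_subset (φ : (Fin d → ℝ) → ℝ) (i : Fin d) :
    tsupport (partialD i φ) ⊆ tsupport φ :=
  tsupport_fderiv_apply_subset ℝ (Pi.single i 1)

/-- Consecutive weak derivatives in one direction are weak derivatives of each other. -/
theorem integral_mul_partialD {U : Set (Fin d → ℝ)} {i : Fin d} {s : ℕ}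
    {f g g' : (Fin d → ℝ) → ℝ} (hg : IsWeakDerivL2 U (Pi.single i s) f g)
    (hg' : IsWeakDerivL2 U (Pi.single i (s + 1)) f g') {φ : (Fin d → ℝ) → ℝ}
    (h1 : ContDiff ℝ (⊤ : ℕ∞) φ) (h2 : HasCompactSupport φ) (h3 : tsupport φ ⊆ U) :
    ∫ x in U, g x * partialD i φ x = -∫ x in U, g' x * φ x := by
  have e1 := hg.2 (partialD i φ) (contDiff_partialD h1 i)
    (h2.mono' ((subset_tsupport _).trans (tsupport_partialD_subset φ i)))
    ((tsupport_partialD_subset φ i).trans h3)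
  have e2 := hg'.2 φ h1 h2 h3
  rw [multiD_single] at e1 e2
  rw [Function.iterate_succ_apply, e1] at e2
  simp only [Finset.sum_pi_single', Finset.mem_univ, if_true] at e2
  rw [pow_succ, mul_assoc] at e2
  simpa using mul_left_cancel₀ (pow_ne_zero s (by norm_num : (-1 : ℝ) ≠ 0)) e2

/-- The weak derivative of order zero is the function itself. -/
theorem ae_eq_of_isWeakDerivL2_zero {U : Set (Fin d → ℝ)} (hU : IsOpen U)
    (hfin : IsFiniteMeasure (volume.restrict U)) {f g : (Fin d → ℝ) → ℝ}
    (hf : MemLp f 2 (volume.restrict U)) (hg : IsWeakDerivL2 U 0 f g) :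
    f =ᵐ[volume.restrict U] g := by
  have hint : Integrable (f - g) (volume.restrict U) := (hf.sub hg.1).integrable (by norm_num)
  have h := hU.ae_eq_zero_of_integral_contDiff_smul_eq_zero (f := f - g) (μ := volume)
    (IntegrableOn.locallyIntegrableOn hint) fun φ h1 h2 h3 => by
      have hz : ∀ x, x ∉ U → φ x • (f - g) x = 0 := fun x hx => by
        rw [image_eq_zero_of_notMem_tsupport fun h => hx (h3 h), zero_smul]
      rw [← setIntegral_eq_integral_of_forall_compl_eq_zero hz]
      have e := hg.2 φ h1 h2 h3
      have hm : multiD (0 : Fin d → ℕ) φ = φ := by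
        have : ∀ l : List (Fin d),
            l.foldr (fun j g => (partialD j)^[(0 : Fin d → ℕ) j] g) φ = φ := fun l => by
          induction l with
          | nil => rfl
          | cons j l ih => simp
        exact this _
      rw [hm] at e
      obtain ⟨B, hB⟩ := h2.exists_bound_of_continuous h1.continuous
      have hI : ∀ k : (Fin d → ℝ) → ℝ, MemLp k 2 (volume.restrict U) →
          Integrable (fun x => k x * φ x) (volume.restrict U) := fun k hk =>
        (hk.integrable (by norm_num)).mul_bdd (c := B) h1.continuous.aestronglyMeasurable
          (Eventually.of_forall hB)
      have : (fun x => φ x • (f - g) x) = fun x => f x * φ x - g x * φ x := by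
        ext x
        simp
        ring
      rw [this, integral_sub (hI f hf) (hI g hg.1), e]
      simp
  filter_upwards [ae_restrict_of_ae h, self_mem_ae_restrict hU.measurableSet] with x hx hxU
  exact sub_eq_zero.1 (hx hxU)

/-- The product of polynomials of one coordinate each, with coordinates centred at `t₀`. -/
def tens (t₀ : ℝ) (P : Fin d → ℝ[X]) (x : Fin d → ℝ) : ℝ := ∏ j, (P j).eval (x j - t₀)

/-- Dominated convergence for products of functions of one coordinate each. -/
theorem tendsto_integral_mul_prod {t₀ : ℝ} {g : (Fin d → ℝ) → ℝ}
    (hg : Integrable g (volume.restrict (interior (cubeAt d t₀))))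
    {H : ℕ → Fin d → ℝ → ℝ} {P : Fin d → ℝ[X]} (hcont : ∀ k j, Continuous (H k j))
    (hbound : ∀ j, ∃ M, ∀ k, ∀ u ∈ Set.Ioo (-1 : ℝ) 1, |H k j u| ≤ M)
    (hlim : ∀ j, ∀ u ∈ Set.Ioo (-1 : ℝ) 1, Tendsto (fun k => H k j u) atTop (𝓝 ((P j).eval u))) :
    Tendsto (fun k => ∫ x in interior (cubeAt d t₀), g x * ∏ j, H k j (x j - t₀)) atTop
      (𝓝 (∫ x in interior (cubeAt d t₀), g x * tens t₀ P x)) := by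
  choose M hM using hbound
  refine tendsto_integral_of_dominated_convergence (fun x => ‖g x‖ * ∏ j, M j) (fun k => ?_)
    (hg.norm.mul_const _) (fun k => ?_) ?_
  · refine hg.aestronglyMeasurable.mul (Continuous.aestronglyMeasurable ?_)
    exact continuous_finsetProd _ fun j _ => (hcont k j).comp (by fun_prop)
  · filter_upwards [self_mem_ae_restrict isOpen_interior.measurableSet] with x hx
    rw [mem_interior_cubeAt] at hx
    rw [norm_mul]
    refine mul_le_mul_of_nonneg_left ?_ (norm_nonneg _)
    rw [Real.norm_eq_abs, Finset.abs_prod]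
    exact Finset.prod_le_prod (fun _ _ => abs_nonneg _) fun j _ => hM j k _ (hx j)
  · filter_upwards [self_mem_ae_restrict isOpen_interior.measurableSet] with x hx
    rw [mem_interior_cubeAt] at hx
    exact (tendsto_finsetProd _ fun j _ => hlim j _ (hx j)).const_mul _

theorem tsupport_prod_cutPoly (t₀ : ℝ) (k : ℕ) (P : Fin d → ℝ[X]) :
    HasCompactSupport (fun x : Fin d → ℝ => ∏ j, cutPoly k (P j) (x j - t₀)) ∧
    tsupport (fun x : Fin d → ℝ => ∏ j, cutPoly k (P j) (x j - t₀)) ⊆ interior (cubeAt d t₀) := by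
  set K : Set (Fin d → ℝ) := {x | ∀ j, 1 ≤ k * (1 - (x j - t₀) ^ 2)} with hK
  have hclosed : IsClosed K := by
    rw [hK, Set.ofPred_forall]
    exact isClosed_iInter fun j => isClosed_le continuous_const (by fun_prop)
  have hsub : K ⊆ interior (cubeAt d t₀) := fun x hx => by
    refine mem_interior_cubeAt.2 fun j => ?_
    have h1 : 0 < 1 - (x j - t₀) ^ 2 := by
      by_contra! h
      linarith [hx j, mul_nonpos_of_nonneg_of_nonpos k.cast_nonneg h]
    exact abs_lt.1 (by rw [← sq_lt_one_iff_abs_lt_one]; linarith)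
  have hcompact : IsCompact K :=
    isCompact_Icc.of_isClosed_subset hclosed (hsub.trans interior_subset)
  have hsupp : Function.support (fun x : Fin d → ℝ => ∏ j, cutPoly k (P j) (x j - t₀)) ⊆ K := by
    intro x hx j
    by_contra! h
    refine hx (Finset.prod_eq_zero (Finset.mem_univ j) ?_)
    rw [cutPoly, bump, Real.smoothTransition.zero_of_nonpos (by linarith), zero_mul]
  exact ⟨HasCompactSupport.of_support_subset_isCompact hcompact hsupp,
    (closure_minimal hsupp hclosed).trans hsub⟩

/-- Integration by parts against polynomials that contain the weight of the coordinate `i`. No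
boundary condition in the other coordinates is needed. -/
theorem integral_mul_tens_derivative {t₀ : ℝ} {i : Fin d} {s : ℕ} {f g g' : (Fin d → ℝ) → ℝ}
    (hg : IsWeakDerivL2 (interior (cubeAt d t₀)) (Pi.single i s) f g)
    (hg' : IsWeakDerivL2 (interior (cubeAt d t₀)) (Pi.single i (s + 1)) f g')
    (P : Fin d → ℝ[X]) (q : ℝ[X]) :
    ∫ x in interior (cubeAt d t₀),
        g x * tens t₀ (Function.update P i (derivative (weight * q))) x
      = -∫ x in interior (cubeAt d t₀), g' x * tens t₀ (Function.update P i (weight * q)) x := by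
  have hfin : IsFiniteMeasure (volume.restrict (interior (cubeAt d t₀))) := by
    rw [restrict_interior_cubeAt]
    infer_instance
  set Q : Fin d → ℝ[X] := Function.update P i (weight * q) with hQ
  set φ : ℕ → (Fin d → ℝ) → ℝ := fun k x => ∏ j, cutPoly k (Q j) (x j - t₀) with hφ
  have hpart : ∀ k x, partialD i (φ k) x = ∏ j,
      Function.update (fun j => cutPoly k (Q j)) i (deriv (cutPoly k (Q i))) j (x j - t₀) := by
    intro k x
    have := partialD_prod (h := fun j u => cutPoly k (Q j) (u - t₀)) (fun j =>
      ((contDiff_cutPoly k (Q j)).differentiable (by simp)).comp (by fun_prop)) i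
    rw [hφ]
    rw [this]
    refine Finset.prod_congr rfl fun j _ => ?_
    by_cases hj : j = i
    · subst hj
      simp only [Function.update_self]
      exact deriv_comp_sub_const _ _ _
    · simp only [Function.update_of_ne hj]
  have hL := tendsto_integral_mul_prod (t₀ := t₀) (hg.1.integrable (by norm_num))
    (H := fun k => Function.update (fun j => cutPoly k (Q j)) i (deriv (cutPoly k (Q i))))
    (P := Function.update P i (derivative (weight * q))) (fun k j => by
      by_cases hj : j = i
      · subst hj
        simpa using (contDiff_cutPoly k (Q j)).continuous_deriv (by simp)
      · simpa [hj] using (contDiff_cutPoly k (Q j)).continuous) (fun j => by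
      by_cases hj : j = i
      · subst hj
        simpa [hQ] using exists_abs_deriv_cutPoly_le q
      · simpa [hj] using exists_abs_cutPoly_le (Q j)) (fun j u hu => by
      by_cases hj : j = i
      · subst hj
        simpa [hQ] using tendsto_deriv_cutPoly (weight * q) hu
      · simpa [hj, hQ] using tendsto_cutPoly (P j) hu)
  have hR := tendsto_integral_mul_prod (t₀ := t₀) (hg'.1.integrable (by norm_num))
    (H := fun k j => cutPoly k (Q j)) (P := Q) (fun k j => (contDiff_cutPoly k (Q j)).continuous)
    (fun j => exists_abs_cutPoly_le (Q j)) (fun j u hu => tendsto_cutPoly (Q j) hu)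
  refine tendsto_nhds_unique hL (hR.neg.congr fun k => ?_)
  have hsm : ContDiff ℝ (⊤ : ℕ∞) (φ k) :=
    contDiff_prod fun j _ => (contDiff_cutPoly k (Q j)).comp (by fun_prop)
  have h := integral_mul_partialD hg hg' hsm (tsupport_prod_cutPoly t₀ k Q).1
    (tsupport_prod_cutPoly t₀ k Q).2
  rw [← h]
  simp only [hpart]

end LegendreSieve

/-! ### The Legendre basis of square integrable functions on a cube -/

namespace LegendreSieve

open Polynomial Filter Topology

variable {d : ℕ}

/-- Products of polynomials in `X_j - t₀`, one for each coordinate, as a multilinear map into the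
polynomials in `d` variables. -/
def tensPoly (t₀ : ℝ) :
    MultilinearMap ℝ (fun _ : Fin d => ℝ[X]) (MvPolynomial (Fin d) ℝ) :=
  (MultilinearMap.mkPiAlgebra ℝ (Fin d) (MvPolynomial (Fin d) ℝ)).compLinearMap fun j =>
    (aeval (MvPolynomial.X j - MvPolynomial.C t₀ : MvPolynomial (Fin d) ℝ)).toLinearMap

theorem tensPoly_apply (t₀ : ℝ) (P : Fin d → ℝ[X]) :
    tensPoly t₀ P = ∏ j, aeval (MvPolynomial.X j - MvPolynomial.C t₀ : MvPolynomial (Fin d) ℝ)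
      (P j) := rfl

theorem eval_tensPoly (t₀ : ℝ) (P : Fin d → ℝ[X]) (x : Fin d → ℝ) :
    MvPolynomial.eval x (tensPoly t₀ P) = tens t₀ P x := by
  rw [tensPoly_apply, map_prod, tens]
  refine Finset.prod_congr rfl fun j _ => ?_
  have := Polynomial.aeval_algHom_apply (MvPolynomial.aeval x : MvPolynomial (Fin d) ℝ →ₐ[ℝ] ℝ)
    (MvPolynomial.X j - MvPolynomial.C t₀) (P j)
  rw [MvPolynomial.aeval_eq_eval] at this
  simpa [Polynomial.aeval_def] using this.symm

theorem continuous_tens (t₀ : ℝ) (P : Fin d → ℝ[X]) : Continuous (tens t₀ P) :=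
  continuous_finsetProd _ fun j _ => (P j).continuous.comp (by fun_prop)

theorem totalDegree_tensPoly_le (t₀ : ℝ) (P : Fin d → ℝ[X]) :
    (tensPoly t₀ P).totalDegree ≤ ∑ j, (P j).natDegree := by
  rw [tensPoly_apply]
  refine (MvPolynomial.totalDegree_finsetProd _ _).trans (Finset.sum_le_sum fun j _ => ?_)
  rw [aeval_eq_sum_range]
  refine MvPolynomial.totalDegree_finsetSum_le fun i hi => ?_
  refine (MvPolynomial.totalDegree_smul_le _ _).trans ((MvPolynomial.totalDegree_pow _ _).trans ?_)
  have h1 : (MvPolynomial.X j - MvPolynomial.C t₀ : MvPolynomial (Fin d) ℝ).totalDegree ≤ 1 :=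
    (MvPolynomial.totalDegree_sub _ _).trans (by simp)
  have h2 : i ≤ (P j).natDegree := Nat.lt_succ_iff.1 (Finset.mem_range.1 hi)
  nlinarith

/-- Every polynomial is a sum of products of polynomials of one coordinate each. -/
theorem span_range_tensPoly (t₀ : ℝ) :
    Submodule.span ℝ (Set.range (tensPoly (d := d) t₀)) = ⊤ := by
  rw [eq_top_iff]
  rintro p -
  rw [p.as_sum]
  refine Submodule.sum_mem _ fun a _ => ?_
  have : MvPolynomial.monomial a (MvPolynomial.coeff a p)
      = MvPolynomial.coeff a p • tensPoly t₀ fun j => (X + C t₀) ^ a j := by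
    rw [tensPoly_apply, MvPolynomial.monomial_eq, MvPolynomial.smul_eq_C_mul]
    congr 1
    rw [Finsupp.prod_fintype _ _ fun _ => pow_zero _]
    refine Finset.prod_congr rfl fun j _ => ?_
    simp [MvPolynomial.algebraMap_eq]
  rw [this]
  exact Submodule.smul_mem _ _ (Submodule.subset_span ⟨_, rfl⟩)

theorem memLp_of_continuous (t₀ : ℝ) {F : (Fin d → ℝ) → ℝ} (hF : Continuous F) :
    MemLp F 2 (volume.restrict (cubeAt d t₀)) := by
  obtain ⟨M, hM⟩ := (isCompact_Icc : IsCompact (cubeAt d t₀)).exists_bound_of_continuousOn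
    hF.continuousOn
  exact MemLp.of_bound hF.aestronglyMeasurable M
    ((ae_restrict_iff' measurableSet_Icc).2 (Eventually.of_forall hM))

/-- Polynomials as square integrable functions on the cube with centre `(t₀, …, t₀)`. -/
def polyLp (t₀ : ℝ) :
    MvPolynomial (Fin d) ℝ →ₗ[ℝ] Lp ℝ 2 (volume.restrict (cubeAt d t₀)) where
  toFun p := (memLp_of_continuous t₀ (MvPolynomial.continuous_eval p)).toLp _
  map_add' p q := by
    rw [← MemLp.toLp_add]
    exact MemLp.toLp_congr _ _ (Eventually.of_forall fun s => by simp)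
  map_smul' r p := by
    rw [RingHom.id_apply, ← MemLp.toLp_const_smul]
    exact MemLp.toLp_congr _ _ (Eventually.of_forall fun s => by simp [MvPolynomial.smul_eval])

theorem coeFn_polyLp (t₀ : ℝ) (p : MvPolynomial (Fin d) ℝ) :
    polyLp t₀ p =ᵐ[volume.restrict (cubeAt d t₀)] fun x => MvPolynomial.eval x p :=
  (memLp_of_continuous t₀ (MvPolynomial.continuous_eval p)).coeFn_toLp

/-- Polynomials are dense in `L²` of a cube. -/
theorem denseRange_polyLp (t₀ : ℝ) : DenseRange (polyLp (d := d) t₀) := by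
  rw [Metric.denseRange_iff]
  set μ : Measure (Fin d → ℝ) := volume.restrict (cubeAt d t₀) with hμ
  intro h ε hε
  obtain ⟨g, -, hg, hgc, hgL⟩ := (Lp.memLp h).exists_hasCompactSupport_eLpNorm_sub_le
    (by norm_num) (ε := ENNReal.ofReal (ε / 2)) (by simpa using hε)
  -- uniform approximation of `g` on the cube up to `δ`
  set V : ℝ := μ.real Set.univ with hV
  set δ : ℝ := ε / 4 / (Real.sqrt V + 1) with hδ
  have hδ0 : 0 < δ := by positivity
  have : CompactSpace (cubeAt d t₀) := isCompact_iff_compactSpace.1 isCompact_Icc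
  let A : MvPolynomial (Fin d) ℝ →ₐ[ℝ] C(cubeAt d t₀, ℝ) :=
    MvPolynomial.aeval fun j =>
      ⟨fun x => (x : Fin d → ℝ) j, (continuous_apply j).comp continuous_subtype_val⟩
  have hA : ∀ p x, A p x = MvPolynomial.eval (x : Fin d → ℝ) p := fun p x => by
    induction p using MvPolynomial.induction_on with
    | C a => simp [A]
    | add p q hp hq => simp [hp, hq]
    | mul_X p j hp => simp [hp, A]
  have hsep : A.range.SeparatesPoints := by
    intro x y hxy
    obtain ⟨j, hj⟩ := Function.ne_iff.1 (Subtype.coe_injective.ne hxy)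
    exact ⟨_, ⟨A (MvPolynomial.X j), ⟨_, rfl⟩, rfl⟩, by simpa [hA] using hj⟩
  obtain ⟨⟨_, p, rfl⟩, hp⟩ :=
    ContinuousMap.exists_mem_subalgebra_near_continuousMap_of_separatesPoints
      A.range hsep ⟨fun x : cubeAt d t₀ => g x, by fun_prop⟩ δ hδ0
  refine ⟨p, ?_⟩
  have hpt : ∀ᵐ x ∂μ, ‖g x - MvPolynomial.eval x p‖ ≤ δ := by
    refine (ae_restrict_iff' measurableSet_Icc).2 (Eventually.of_forall fun x hx => ?_)
    have h1 := (ContinuousMap.norm_coe_le_norm _ (⟨x, hx⟩ : cubeAt d t₀)).trans hp.le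
    rw [norm_sub_rev]
    have e : (A p) ⟨x, hx⟩ = MvPolynomial.eval x p := hA p ⟨x, hx⟩
    simpa [e] using h1
  have h2 : ‖hgL.toLp g - polyLp t₀ p‖ ≤ ε / 4 := by
    have h3 : ‖hgL.toLp g - polyLp t₀ p‖ ≤ μ.real Set.univ ^ ((2 : ENNReal).toReal⁻¹) * δ := by
      refine Lp.norm_le_of_ae_bound hδ0.le ?_
      filter_upwards [hpt, Lp.coeFn_sub (hgL.toLp g) (polyLp t₀ p), hgL.coeFn_toLp,
        coeFn_polyLp t₀ p] with x hx h1 h2 h3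
      rwa [h1, Pi.sub_apply, h2, h3]
    refine h3.trans ?_
    have h4 : μ.real Set.univ ^ ((2 : ENNReal).toReal⁻¹) = Real.sqrt V := by
      rw [Real.sqrt_eq_rpow]
      norm_num [hV]
    rw [h4, hδ]
    have h5 := Real.sqrt_nonneg V
    rw [mul_div_assoc', div_le_iff₀ (by positivity)]
    nlinarith
  have h6 : ‖h - hgL.toLp g‖ ≤ ε / 2 := by
    have e : h - hgL.toLp g = ((Lp.memLp h).sub hgL).toLp _ := by
      rw [MemLp.toLp_sub (Lp.memLp h) hgL, Lp.toLp_coeFn]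
    rw [e, Lp.norm_toLp]
    exact ENNReal.toReal_le_of_le_ofReal (by positivity) hg
  rw [dist_eq_norm]
  calc ‖h - polyLp t₀ p‖ ≤ ‖h - hgL.toLp g‖ + ‖hgL.toLp g - polyLp t₀ p‖ :=
        norm_sub_le_norm_sub_add_norm_sub _ _ _
    _ < ε := by linarith

theorem integral_tens (t₀ : ℝ) (P : Fin d → ℝ[X]) :
    ∫ x in cubeAt d t₀, tens t₀ P x = ∏ j, ∫ u in (-1 : ℝ)..1, (P j).eval u := by
  have hμ : (volume.restrict (cubeAt d t₀) : Measure (Fin d → ℝ))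
      = Measure.pi fun _ => volume.restrict (Set.Icc (-1 + t₀) (1 + t₀)) := by
    rw [cubeAt, ← Set.pi_univ_Icc, volume_pi, Measure.restrict_pi_pi]
  rw [hμ]
  unfold tens
  rw [integral_fintype_prod_eq_prod (fun j u => (P j).eval (u - t₀))]
  refine Finset.prod_congr rfl fun j _ => ?_
  rw [integral_Icc_eq_integral_Ioc, ← intervalIntegral.integral_of_le (by linarith),
    intervalIntegral.integral_comp_sub_right (fun u => (P j).eval u)]
  simp

/-- Orthogonal square integrable functions, normalized. -/
theorem orthonormal_smul_toLp {α ι : Type*} [DecidableEq ι] [MeasurableSpace α] {μ : Measure α}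
    {F : ι → α → ℝ} (hF : ∀ i, MemLp (F i) 2 μ) {N : ι → ℝ} (hN : ∀ i, 0 < N i)
    (h : ∀ i k, ∫ x, F i x * F k x ∂μ = if i = k then N i else 0) :
    Orthonormal ℝ fun i => (Real.sqrt (N i))⁻¹ • (hF i).toLp (F i) := by
  rw [orthonormal_iff_ite]
  intro i k
  have e : inner ℝ ((hF i).toLp (F i)) ((hF k).toLp (F k)) = ∫ x, F i x * F k x ∂μ := by
    rw [L2.inner_def]
    refine integral_congr_ae ?_
    filter_upwards [(hF i).coeFn_toLp, (hF k).coeFn_toLp] with x h1 h2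
    rw [h1, h2]
    simp [mul_comm]
  rw [inner_smul_left, inner_smul_right, e, h]
  split_ifs with hik
  · subst hik
    have := Real.mul_self_sqrt (hN i).le
    have h0 := (Real.sqrt_pos.2 (hN i)).ne'
    simp only [conj_trivial]
    field_simp
    linarith
  · simp

/-- The squared norm of the product of the Legendre polynomials of degrees `n j`. -/
def tensNormSq (n : Fin d → ℕ) : ℝ := ∏ j, pairing 0 (n j) (n j)

theorem tensNormSq_pos (n : Fin d → ℕ) : 0 < tensNormSq n :=
  Finset.prod_pos fun j _ => pairing_self_pos (n j)

theorem prod_pairing_ite (s : Fin d → ℕ) (n k : Fin d → ℕ) :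
    ∏ j, pairing (s j) (n j) (k j) = if n = k then ∏ j, pairing (s j) (n j) (n j) else 0 := by
  split_ifs with h
  · rw [h]
  · obtain ⟨j, hj⟩ := Function.ne_iff.1 h
    exact Finset.prod_eq_zero (Finset.mem_univ j) (pairing_of_ne _ hj)

/-- Normalized products of Legendre polynomials. -/
def legendreLp (t₀ : ℝ) (n : Fin d → ℕ) : Lp ℝ 2 (volume.restrict (cubeAt d t₀)) :=
  (Real.sqrt (tensNormSq n))⁻¹ • polyLp t₀ (tensPoly t₀ fun j => legendre (n j))

theorem orthonormal_legendreLp (t₀ : ℝ) : Orthonormal ℝ (legendreLp (d := d) t₀) := by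
  have key := orthonormal_smul_toLp (μ := volume.restrict (cubeAt d t₀))
    (F := fun (n : Fin d → ℕ) x => MvPolynomial.eval x (tensPoly t₀ fun j => legendre (n j)))
    (fun n => memLp_of_continuous t₀ (MvPolynomial.continuous_eval _)) tensNormSq_pos
  refine key fun n k => ?_
  have : ∀ x : Fin d → ℝ, MvPolynomial.eval x (tensPoly t₀ fun j => legendre (n j))
      * MvPolynomial.eval x (tensPoly t₀ fun j => legendre (k j))
      = tens t₀ (fun j => weight ^ 0 * derivative^[0] (legendre (n j))
          * derivative^[0] (legendre (k j))) x := fun x => by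
    rw [eval_tensPoly, eval_tensPoly]
    simp [tens, Finset.prod_mul_distrib]
  simp_rw [this]
  rw [integral_tens]
  exact prod_pairing_ite 0 n k

theorem orthogonal_span_legendreLp (t₀ : ℝ) :
    (Submodule.span ℝ (Set.range (legendreLp (d := d) t₀)))ᗮ = ⊥ := by
  rw [eq_bot_iff]
  intro h hh
  -- the functional `p ↦ ⟨h, p⟩` vanishes on products of Legendre polynomials, hence on all
  -- products, hence on all polynomials
  have h1 : ∀ n : Fin d → ℕ,
      inner ℝ h (polyLp t₀ (tensPoly t₀ fun j => legendre (n j))) = (0 : ℝ) := by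
    intro n
    have := (Submodule.mem_orthogonal' _ _).1 hh _ (Submodule.subset_span ⟨n, rfl⟩)
    rw [legendreLp, inner_smul_right] at this
    exact (mul_eq_zero.1 this).resolve_left
      (inv_ne_zero (Real.sqrt_pos.2 (tensNormSq_pos n)).ne')
  let T : MvPolynomial (Fin d) ℝ →ₗ[ℝ] ℝ := (innerSL ℝ h).toLinearMap ∘ₗ polyLp t₀
  have h2 : T.compMultilinearMap (tensPoly t₀) = 0 :=
    Module.Basis.ext_multilinear (fun _ => legendreBasis) fun n => by
      simpa [legendreBasis_apply, T] using h1 n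
  have h3 : T = 0 := by
    refine LinearMap.ext_on_range (span_range_tensPoly t₀) fun P => ?_
    exact DFunLike.congr_fun h2 P
  have h4 : ∀ y, inner ℝ h y = (0 : ℝ) := by
    have := (denseRange_polyLp (d := d) t₀).equalizer (g := fun y => (inner ℝ h y : ℝ))
      (h := fun _ => (0 : ℝ)) (by fun_prop) continuous_const
      (funext fun p => DFunLike.congr_fun h3 p)
    exact fun y => congrFun this y
  exact inner_self_eq_zero.1 (h4 h)

/-- Normalized products of Legendre polynomials form a Hilbert basis. -/
def legendreHilbertBasis (d : ℕ) (t₀ : ℝ) :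
    HilbertBasis (Fin d → ℕ) ℝ (Lp ℝ 2 (volume.restrict (cubeAt d t₀))) :=
  HilbertBasis.mkOfOrthogonalEqBot (orthonormal_legendreLp t₀) (orthogonal_span_legendreLp t₀)

theorem legendreHilbertBasis_apply (t₀ : ℝ) (n : Fin d → ℕ) :
    legendreHilbertBasis d t₀ n = legendreLp t₀ n := by
  rw [legendreHilbertBasis, HilbertBasis.coe_mkOfOrthogonalEqBot]

end LegendreSieve

/-! ### The rate of approximation on a cube -/

namespace LegendreSieve

open Polynomial Filter Topology

variable {d : ℕ}

theorem tens_update_neg_smul (t₀ : ℝ) (P : Fin d → ℝ[X]) (i : Fin d) (e : ℝ) (q : ℝ[X])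
    (x : Fin d → ℝ) :
    tens t₀ (Function.update P i (-(C e * q))) x = -e * tens t₀ (Function.update P i q) x := by
  rw [← eval_tensPoly, ← eval_tensPoly, show -(C e * q) = (-e) • q by
    rw [neg_smul, smul_eq_C_mul], MultilinearMap.map_update_smul, MvPolynomial.smul_eval]

/-- Moving `s` derivatives in direction `i` from a product of Legendre polynomials to `f`
multiplies the integral by the product of the first `s` eigenvalues. -/
theorem integral_weakDeriv_mul_tens {t₀ : ℝ} {i : Fin d} {r : ℕ} {f : (Fin d → ℝ) → ℝ}
    {G : ℕ → (Fin d → ℝ) → ℝ}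
    (hG : ∀ s ≤ r, IsWeakDerivL2 (interior (cubeAt d t₀)) (Pi.single i s) f (G s))
    (n : Fin d → ℕ) {s : ℕ} (hs : s ≤ r) :
    ∫ x in interior (cubeAt d t₀), G s x * tens t₀ (Function.update (fun j => legendre (n j)) i
        (weight ^ s * derivative^[s] (legendre (n i)))) x
      = (∏ k ∈ Finset.range s, eig (n i) k) *
        ∫ x in interior (cubeAt d t₀), G 0 x * tens t₀ (fun j => legendre (n j)) x := by
  induction s with
  | zero =>
    simp
  | succ s ih =>
    have h := integral_mul_tens_derivative (hG s (by omega)) (hG (s + 1) hs)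
      (fun j => legendre (n j)) (weight ^ s * derivative^[s + 1] (legendre (n i)))
    rw [← mul_assoc, ← pow_succ', derivative_weight_pow_mul] at h
    simp_rw [tens_update_neg_smul] at h
    simp_rw [mul_left_comm _ (-eig (n i) s)] at h
    rw [integral_const_mul, ih (by omega)] at h
    rw [Finset.prod_range_succ]
    linear_combination h

/-- The square root of the weight `(1 - u²)ʳ` in the coordinate `i`. It is continuous, and
bounded by one on the cube. -/
def sqrtWeight (t₀ : ℝ) (i : Fin d) (r : ℕ) (x : Fin d → ℝ) : ℝ :=
  Real.sqrt (weight.eval (x i - t₀)) ^ r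

theorem continuous_sqrtWeight (t₀ : ℝ) (i : Fin d) (r : ℕ) :
    Continuous (sqrtWeight t₀ i r) :=
  (Real.continuous_sqrt.comp (weight.continuous.comp (by fun_prop))).pow r

theorem sqrtWeight_nonneg (t₀ : ℝ) (i : Fin d) (r : ℕ) (x : Fin d → ℝ) :
    0 ≤ sqrtWeight t₀ i r x := pow_nonneg (Real.sqrt_nonneg _) _

theorem sqrtWeight_le_one (t₀ : ℝ) (i : Fin d) (r : ℕ) (x : Fin d → ℝ) :
    sqrtWeight t₀ i r x ≤ 1 := by
  refine pow_le_one₀ (Real.sqrt_nonneg _) (Real.sqrt_le_one.2 ?_)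
  simp only [weight, eval_sub, eval_one, eval_pow, eval_X]
  linarith [sq_nonneg (x i - t₀)]

theorem sqrtWeight_mul_self {t₀ : ℝ} (i : Fin d) (r : ℕ) {x : Fin d → ℝ} (hx : x ∈ cubeAt d t₀) :
    sqrtWeight t₀ i r x * sqrtWeight t₀ i r x = (weight ^ r).eval (x i - t₀) := by
  have h := mem_cubeAt.1 hx i
  rw [sqrtWeight, ← mul_pow, Real.mul_self_sqrt, eval_pow]
  simp only [weight, eval_sub, eval_one, eval_pow, eval_X]
  nlinarith [h.1, h.2]

theorem tens_update (t₀ : ℝ) (P : Fin d → ℝ[X]) (i : Fin d) (q : ℝ[X]) (x : Fin d → ℝ) :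
    tens t₀ (Function.update P i q) x
      = q.eval (x i - t₀) * ∏ j ∈ Finset.univ.erase i, (P j).eval (x j - t₀) := by
  rw [tens, ← Finset.mul_prod_erase _ _ (Finset.mem_univ i), Function.update_self]
  congr 1
  exact Finset.prod_congr rfl fun j hj => by rw [Function.update_of_ne (Finset.ne_of_mem_erase hj)]

/-- The `r`-th derivative in direction `i` of a product of Legendre polynomials, with the square
root of its natural weight. -/
def weightedDeriv (t₀ : ℝ) (i : Fin d) (r : ℕ) (n : Fin d → ℕ) (x : Fin d → ℝ) : ℝ :=
  sqrtWeight t₀ i r x * tens t₀ (Function.update (fun j => legendre (n j)) i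
    (derivative^[r] (legendre (n i)))) x

theorem continuous_weightedDeriv (t₀ : ℝ) (i : Fin d) (r : ℕ) (n : Fin d → ℕ) :
    Continuous (weightedDeriv t₀ i r n) :=
  (continuous_sqrtWeight t₀ i r).mul (continuous_tens _ _)

theorem integral_weightedDeriv_mul (t₀ : ℝ) (i : Fin d) (r : ℕ) (n k : Fin d → ℕ) :
    ∫ x in cubeAt d t₀, weightedDeriv t₀ i r n x * weightedDeriv t₀ i r k x
      = if n = k then (∏ s ∈ Finset.range r, eig (n i) s) * tensNormSq n else 0 := by
  have h : ∀ x ∈ cubeAt d t₀, weightedDeriv t₀ i r n x * weightedDeriv t₀ i r k x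
      = tens t₀ (fun j => weight ^ (Pi.single i r : Fin d → ℕ) j
          * derivative^[(Pi.single i r : Fin d → ℕ) j] (legendre (n j))
          * derivative^[(Pi.single i r : Fin d → ℕ) j] (legendre (k j))) x := by
    intro x hx
    rw [weightedDeriv, weightedDeriv, mul_mul_mul_comm, sqrtWeight_mul_self i r hx, tens_update,
      tens_update, tens, ← Finset.mul_prod_erase _ _ (Finset.mem_univ i), mul_mul_mul_comm,
      ← Finset.prod_mul_distrib, ← mul_assoc]
    congr 1
    · simp [mul_assoc]
    · exact Finset.prod_congr rfl fun j hj => by simp [Finset.ne_of_mem_erase hj]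
  rw [setIntegral_congr_fun (show MeasurableSet (cubeAt d t₀) from measurableSet_Icc) h,
    integral_tens]
  refine (prod_pairing_ite (Pi.single i r) n k).trans ?_
  congr 1
  rw [tensNormSq, ← Finset.mul_prod_erase _ _ (Finset.mem_univ i),
    ← Finset.mul_prod_erase _ _ (Finset.mem_univ i), ← mul_assoc, Pi.single_eq_same,
    pairing_eq_prod]
  congr 1
  exact Finset.prod_congr rfl fun j hj => by simp [Finset.ne_of_mem_erase hj]

/-- The Legendre coefficients of high degree in one direction: Bessel's inequality for the
orthogonal system of weighted derivatives, whose normalizing factors gain the product of the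
eigenvalues. -/
theorem sum_inner_legendreLp_sq_le {t₀ : ℝ} {i : Fin d} {r κ : ℕ} (hr : 1 ≤ r)
    (hκ : 2 * d * r ≤ κ) {f : (Fin d → ℝ) → ℝ} {G : ℕ → (Fin d → ℝ) → ℝ}
    (hG : ∀ s ≤ r, IsWeakDerivL2 (interior (cubeAt d t₀)) (Pi.single i s) f (G s))
    {F : Lp ℝ 2 (volume.restrict (cubeAt d t₀))} (hF : F =ᵐ[volume.restrict (cubeAt d t₀)] G 0)
    (A : Finset (Fin d → ℕ)) (hA : ∀ n ∈ A, κ < d * n i) :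
    ∑ n ∈ A, (inner ℝ (legendreLp t₀ n) F) ^ 2
      ≤ ((2 * d / κ : ℝ) ^ r *
        (eLpNorm (G r) 2 (volume.restrict (cubeAt d t₀))).toReal) ^ 2 := by
  have hd : 0 < d := Fin.pos i
  have hκ0 : 0 < κ := lt_of_lt_of_le (by positivity) hκ
  have hGr : MemLp (G r) 2 (volume.restrict (cubeAt d t₀)) := by
    rw [← restrict_interior_cubeAt]
    exact (hG r le_rfl).1
  have hlow : ∀ n : {n : Fin d → ℕ // κ < d * n i},
      ((κ : ℝ) / (2 * d)) ^ (2 * r) ≤ ∏ s ∈ Finset.range r, eig (n.1 i) s := by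
    rintro ⟨n, hn⟩
    refine le_trans ?_ (le_prod_eig (n := n i) (r := r) ?_)
    · have : (κ : ℝ) ≤ d * n i := by exact_mod_cast hn.le
      refine pow_le_pow_left₀ (by positivity) ?_ _
      rw [div_le_div_iff₀ (by positivity) (by positivity)]
      linarith
    · by_contra! h
      have : d * n i ≤ d * (2 * r) := Nat.mul_le_mul_left _ h.le
      nlinarith
  have hpos : ∀ n : {n : Fin d → ℕ // κ < d * n i}, 0 < ∏ s ∈ Finset.range r, eig (n.1 i) s :=
    fun n => lt_of_lt_of_le (by positivity) (hlow n)
  set H : Lp ℝ 2 (volume.restrict (cubeAt d t₀)) :=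
    (show MemLp (fun x => sqrtWeight t₀ i r x * G r x) 2 (volume.restrict (cubeAt d t₀)) from
      hGr.of_le ((continuous_sqrtWeight t₀ i r).aestronglyMeasurable.mul hGr.aestronglyMeasurable)
        (Eventually.of_forall fun x => by
          rw [norm_mul, Real.norm_of_nonneg (sqrtWeight_nonneg _ _ _ _)]
          exact mul_le_of_le_one_left (norm_nonneg _) (sqrtWeight_le_one _ _ _ _))).toLp _ with hH
  have hHae : H =ᵐ[volume.restrict (cubeAt d t₀)] fun x => sqrtWeight t₀ i r x * G r x :=
    MemLp.coeFn_toLp _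
  have hHnorm : ‖H‖ ≤ (eLpNorm (G r) 2 (volume.restrict (cubeAt d t₀))).toReal := by
    rw [hH, Lp.norm_toLp]
    refine ENNReal.toReal_mono hGr.eLpNorm_ne_top (eLpNorm_mono fun x => ?_)
    rw [norm_mul, Real.norm_of_nonneg (sqrtWeight_nonneg _ _ _ _)]
    exact mul_le_of_le_one_left (norm_nonneg _) (sqrtWeight_le_one _ _ _ _)
  have hv := orthonormal_smul_toLp (μ := volume.restrict (cubeAt d t₀))
    (F := fun n : {n : Fin d → ℕ // κ < d * n i} => weightedDeriv t₀ i r n.1)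
    (fun n => memLp_of_continuous t₀ (continuous_weightedDeriv t₀ i r n.1))
    (N := fun n => (∏ s ∈ Finset.range r, eig (n.1 i) s) * tensNormSq n.1)
    (fun n => mul_pos (hpos n) (tensNormSq_pos n.1)) (fun n k => by
      rw [integral_weightedDeriv_mul]
      simp only [Subtype.ext_iff])
  have hcoef : ∀ n : {n : Fin d → ℕ // κ < d * n i},
      inner ℝ ((Real.sqrt ((∏ s ∈ Finset.range r, eig (n.1 i) s) * tensNormSq n.1))⁻¹ •
        (memLp_of_continuous t₀ (continuous_weightedDeriv t₀ i r n.1)).toLp _) H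
      = Real.sqrt (∏ s ∈ Finset.range r, eig (n.1 i) s) * inner ℝ (legendreLp t₀ n.1) F := by
    intro n
    have e1 : inner ℝ ((memLp_of_continuous t₀ (continuous_weightedDeriv t₀ i r n.1)).toLp _) H
        = ∫ x in interior (cubeAt d t₀), G r x *
          tens t₀ (Function.update (fun j => legendre (n.1 j)) i
            (weight ^ r * derivative^[r] (legendre (n.1 i)))) x := by
      rw [L2.inner_def, restrict_interior_cubeAt]
      refine integral_congr_ae ?_
      filter_upwards [(memLp_of_continuous t₀ (continuous_weightedDeriv t₀ i r n.1)).coeFn_toLp,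
        hHae, self_mem_ae_restrict measurableSet_Icc] with x h1 h2 h3
      rw [h1, h2, tens_update, eval_mul, ← sqrtWeight_mul_self i r h3, weightedDeriv, tens_update]
      simp only [RCLike.inner_apply, conj_trivial]
      ring
    have e2 : inner ℝ (polyLp t₀ (tensPoly t₀ fun j => legendre (n.1 j))) F
        = ∫ x in interior (cubeAt d t₀), G 0 x * tens t₀ (fun j => legendre (n.1 j)) x := by
      rw [L2.inner_def, restrict_interior_cubeAt]
      refine integral_congr_ae ?_
      filter_upwards [coeFn_polyLp t₀ (tensPoly t₀ fun j => legendre (n.1 j)), hF] with x h1 h2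
      rw [h1, h2, eval_tensPoly]
      simp
    rw [inner_smul_left, e1, integral_weakDeriv_mul_tens hG n.1 le_rfl, ← e2, legendreLp,
      inner_smul_left, Real.sqrt_mul (hpos n).le]
    have h1 := Real.mul_self_sqrt (hpos n).le
    have h2 := (Real.sqrt_pos.2 (hpos n)).ne'
    simp only [conj_trivial]
    rw [mul_inv, ← mul_assoc, ← mul_assoc]
    congr 1
    nth_rewrite 2 [← h1]
    field_simp
  have hbes := hv.sum_inner_products_le (x := H) (s := A.subtype fun n => κ < d * n i)
  simp only [hcoef] at hbes
  have hsum : ∑ n ∈ A, (inner ℝ (legendreLp t₀ n) F) ^ 2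
      = ∑ n ∈ A.subtype (fun n => κ < d * n i), (inner ℝ (legendreLp t₀ n.1) F) ^ 2 :=
    (Finset.sum_subtype_of_mem (fun n => (inner ℝ (legendreLp t₀ n) F) ^ 2) hA).symm
  rw [hsum]
  calc ∑ n ∈ A.subtype (fun n => κ < d * n i), (inner ℝ (legendreLp t₀ n.1) F) ^ 2
      ≤ ∑ n ∈ A.subtype (fun n => κ < d * n i), (2 * d / κ : ℝ) ^ (2 * r) *
        ‖Real.sqrt (∏ s ∈ Finset.range r, eig (n.1 i) s) * inner ℝ (legendreLp t₀ n.1) F‖ ^ 2 := by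
        refine Finset.sum_le_sum fun n _ => ?_
        rw [norm_mul, mul_pow, Real.norm_eq_abs, Real.norm_eq_abs, sq_abs, sq_abs,
          Real.sq_sqrt (hpos n).le, ← mul_assoc]
        refine le_mul_of_one_le_left (sq_nonneg _) ?_
        calc (1 : ℝ) = (2 * d / κ : ℝ) ^ (2 * r) * ((κ : ℝ) / (2 * d)) ^ (2 * r) := by
              rw [← mul_pow, div_mul_div_cancel₀ (by positivity), div_self (by positivity), one_pow]
          _ ≤ _ := by gcongr; exact hlow n
    _ ≤ (2 * d / κ : ℝ) ^ (2 * r) * ‖H‖ ^ 2 := by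
        rw [← Finset.mul_sum]
        gcongr
    _ ≤ _ := by
        rw [mul_pow, ← pow_mul, mul_comm r 2]
        gcongr

theorem eLpNorm_weakDeriv_le_normW2 {U : Set (Fin d → ℝ)} {r : ℕ} (f : (Fin d → ℝ) → ℝ)
    {α : Fin d → ℕ} (hα : ∑ i, α i ≤ r) :
    (eLpNorm (weakDeriv U α f) 2 (volume.restrict U)).toReal ≤ normW2 U r f := by
  refine Real.le_sqrt_of_sq_le ?_
  refine le_trans ?_ (Finset.single_le_sum (f := fun k =>
    ∑ α ∈ Finset.piAntidiag (Finset.univ : Finset (Fin d)) k,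
      (eLpNorm (weakDeriv U α f) 2 (volume.restrict U)).toReal ^ 2)
    (fun k _ => Finset.sum_nonneg fun _ _ => sq_nonneg _)
    (Finset.mem_range.2 (Nat.lt_succ_of_le hα)))
  exact Finset.single_le_sum (f := fun α =>
      (eLpNorm (weakDeriv U α f) 2 (volume.restrict U)).toReal ^ 2)
    (fun _ _ => sq_nonneg _) (by simp [Finset.mem_piAntidiag])

theorem isWeakDerivL2_weakDeriv {U : Set (Fin d → ℝ)} {r : ℕ} {f : (Fin d → ℝ) → ℝ}
    (hf : MemW2 U r f) {α : Fin d → ℕ} (hα : ∑ i, α i ≤ r) :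
    IsWeakDerivL2 U α f (weakDeriv U α f) := by
  have h := hf.2 α hα
  rw [weakDeriv, dif_pos h]
  exact h.choose_spec

/-- Truncation of the Legendre expansion at total degree `κ`. An index of total degree above `κ`
has a component above `κ / d`, so that the tail splits into one part for each direction. -/
theorem exists_norm_sub_polyLp_le {t₀ : ℝ} {r κ : ℕ} (hr : 1 ≤ r) (hκ : 2 * d * r ≤ κ)
    {f : (Fin d → ℝ) → ℝ} (hf : MemW2 (interior (cubeAt d t₀)) r f)
    {F : Lp ℝ 2 (volume.restrict (cubeAt d t₀))} (hF : F =ᵐ[volume.restrict (cubeAt d t₀)] f) :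
    ∃ p : MvPolynomial (Fin d) ℝ, p.totalDegree ≤ κ ∧
      ‖F - polyLp t₀ p‖ ≤ d * ((2 * d / κ : ℝ) ^ r * normW2 (interior (cubeAt d t₀)) r f) := by
  set U := interior (cubeAt d t₀) with hU
  have hfin : IsFiniteMeasure (volume.restrict U) := by
    rw [hU, restrict_interior_cubeAt]
    infer_instance
  have hW0 : 0 ≤ normW2 U r f := Real.sqrt_nonneg _
  set b := legendreHilbertBasis d t₀ with hb
  set I : Finset (Fin d → ℕ) :=
    (Fintype.piFinset fun _ => Finset.range (κ + 1)).filter fun n => ∑ j, n j ≤ κ with hI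
  have hmemI : ∀ n : Fin d → ℕ, n ∈ I ↔ ∑ j, n j ≤ κ := fun n => by
    simp only [hI, Finset.mem_filter, Fintype.mem_piFinset, Finset.mem_range, and_iff_right_iff_imp]
    exact fun h j => Nat.lt_succ_of_le
      ((Finset.single_le_sum (fun _ _ => Nat.zero_le _) (Finset.mem_univ j)).trans h)
  set p : MvPolynomial (Fin d) ℝ := ∑ n ∈ I, (inner ℝ (b n) F * (Real.sqrt (tensNormSq n))⁻¹) •
    tensPoly t₀ fun j => legendre (n j) with hp
  have hpb : polyLp t₀ p = ∑ n ∈ I, (inner ℝ (b n) F : ℝ) • b n := by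
    rw [hp, map_sum]
    refine Finset.sum_congr rfl fun n _ => ?_
    rw [map_smul, hb, legendreHilbertBasis_apply, legendreLp, smul_smul]
  refine ⟨p, MvPolynomial.totalDegree_finsetSum_le fun n hn => ?_, ?_⟩
  · refine (MvPolynomial.totalDegree_smul_le _ _).trans ((totalDegree_tensPoly_le _ _).trans ?_)
    exact (Finset.sum_le_sum fun j _ => natDegree_legendre_le (n j)).trans ((hmemI n).1 hn)
  have hcoef : ∀ n, (inner ℝ (b n) (F - polyLp t₀ p) : ℝ)
      = if ∑ j, n j ≤ κ then 0 else inner ℝ (b n) F := fun n => by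
    rw [inner_sub_right, hpb]
    split_ifs with h
    · rw [b.orthonormal.inner_right_sum _ ((hmemI n).2 h), sub_self]
    · rw [inner_sum, Finset.sum_eq_zero fun k hk => ?_, sub_zero]
      have : n ≠ k := fun e => h ((hmemI n).1 (e ▸ hk))
      rw [inner_smul_right, b.orthonormal.inner_eq_zero this, mul_zero]
  set B : ℝ := (2 * d / κ : ℝ) ^ r * normW2 U r f with hB
  have hB0 : 0 ≤ B := by positivity
  have hdir : ∀ (i : Fin d) (A : Finset (Fin d → ℕ)),
      ∑ n ∈ A.filter (fun n => κ < d * n i), (inner ℝ (b n) F : ℝ) ^ 2 ≤ B ^ 2 := by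
    intro i A
    have hsingle : ∀ s ≤ r, ∑ j, (Pi.single i s : Fin d → ℕ) j ≤ r := fun s hs => by
      simpa using hs
    have hG : ∀ s ≤ r, IsWeakDerivL2 U (Pi.single i s) f (weakDeriv U (Pi.single i s) f) :=
      fun s hs => isWeakDerivL2_weakDeriv hf (hsingle s hs)
    have h0 : F =ᵐ[volume.restrict (cubeAt d t₀)] weakDeriv U (Pi.single i 0) f := by
      refine hF.trans ?_
      rw [← restrict_interior_cubeAt]
      refine ae_eq_of_isWeakDerivL2_zero isOpen_interior hfin hf.1 ?_
      simpa using hG 0 (Nat.zero_le r)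
    simp only [hb, legendreHilbertBasis_apply]
    refine (sum_inner_legendreLp_sq_le hr hκ (G := fun s => weakDeriv U (Pi.single i s) f) hG h0 _
      fun n hn => (Finset.mem_filter.1 hn).2).trans ?_
    have := eLpNorm_weakDeriv_le_normW2 (U := U) (r := r) f (hsingle r le_rfl)
    rw [hU, restrict_interior_cubeAt] at this
    rw [hB]
    gcongr
  have hsq : ‖F - polyLp t₀ p‖ ^ 2 ≤ d * B ^ 2 := by
    have hs := b.hasSum_inner_mul_inner (F - polyLp t₀ p) (F - polyLp t₀ p)
    rw [real_inner_self_eq_norm_sq] at hs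
    refine hasSum_le_of_sum_le hs fun A => ?_
    calc ∑ n ∈ A, (inner ℝ (F - polyLp t₀ p) (b n) * inner ℝ (b n) (F - polyLp t₀ p) : ℝ)
        ≤ ∑ n ∈ A, ∑ i : Fin d, if κ < d * n i then (inner ℝ (b n) F : ℝ) ^ 2 else 0 := by
          refine Finset.sum_le_sum fun n _ => ?_
          have hnn : ∀ i ∈ (Finset.univ : Finset (Fin d)),
              (0 : ℝ) ≤ if κ < d * n i then (inner ℝ (b n) F : ℝ) ^ 2 else 0 := fun i _ => by
            split_ifs
            · exact sq_nonneg _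
            · exact le_rfl
          rw [real_inner_comm, hcoef]
          split_ifs with h
          · simpa using Finset.sum_nonneg hnn
          · obtain ⟨i, hi⟩ : ∃ i, κ < d * n i := by
              by_contra! hall
              refine h (Nat.le_of_mul_le_mul_left (c := ?_) ?_ ?_)
              · exact d
              · rw [Finset.mul_sum]
                simpa using Finset.sum_le_sum fun i (_ : i ∈ Finset.univ) => hall i
              · rcases Nat.eq_zero_or_pos d with rfl | hd
                · simp at h
                · exact hd
            refine le_trans (le_of_eq ?_) (Finset.single_le_sum hnn (Finset.mem_univ i))
            rw [if_pos hi, sq]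
      _ = ∑ i : Fin d, ∑ n ∈ A.filter (fun n => κ < d * n i), (inner ℝ (b n) F : ℝ) ^ 2 := by
          rw [Finset.sum_comm]
          exact Finset.sum_congr rfl fun i _ => (Finset.sum_filter _ _).symm
      _ ≤ ∑ i : Fin d, B ^ 2 := Finset.sum_le_sum fun i _ => hdir i A
      _ = d * B ^ 2 := by simp
  refine abs_le_of_sq_le_sq' ?_ (by positivity) |>.2
  rw [mul_pow]
  refine hsq.trans ?_
  gcongr
  exact_mod_cast Nat.le_self_pow two_ne_zero d

/-- The approximation theorem for one cube, without a lower bound for `κ` in terms of `r`. -/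
theorem exists_eLpNorm_sub_le {t₀ : ℝ} {r κ : ℕ} (hd : 1 ≤ d) (hr : 1 ≤ r) (hκ : 1 ≤ κ)
    {f : (Fin d → ℝ) → ℝ} (hf : MemW2 (interior (cubeAt d t₀)) r f) {C : ℝ}
    (hC : normW2 (interior (cubeAt d t₀)) r f ≤ C) :
    ∃ p : MvPolynomial (Fin d) ℝ, p.totalDegree ≤ κ ∧
      (eLpNorm (fun x => f x - MvPolynomial.eval x p) 2 (volume.restrict (cubeAt d t₀))).toReal
        ≤ C * (d * (2 * d * r) ^ r) * ((κ : ℝ) ^ r)⁻¹ := by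
  have hW0 : 0 ≤ normW2 (interior (cubeAt d t₀)) r f := Real.sqrt_nonneg _
  have hC0 : 0 ≤ C := hW0.trans hC
  have hd1 : (1 : ℝ) ≤ d := by exact_mod_cast hd
  have hr1 : (1 : ℝ) ≤ r := by exact_mod_cast hr
  have hκ1 : (1 : ℝ) ≤ κ := by exact_mod_cast hκ
  have hfL : MemLp f 2 (volume.restrict (cubeAt d t₀)) := by
    rw [← restrict_interior_cubeAt]
    exact hf.1
  rcases le_or_gt (2 * d * r) κ with h | h
  · obtain ⟨p, hp, hle⟩ := exists_norm_sub_polyLp_le hr h hf hfL.coeFn_toLp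
    refine ⟨p, hp, ?_⟩
    have e : hfL.toLp f - polyLp t₀ p = (hfL.sub
        (memLp_of_continuous t₀ (MvPolynomial.continuous_eval p))).toLp _ :=
      (MemLp.toLp_sub hfL (memLp_of_continuous t₀ (MvPolynomial.continuous_eval p))).symm
    rw [e, Lp.norm_toLp] at hle
    refine hle.trans ?_
    calc (d : ℝ) * ((2 * d / κ : ℝ) ^ r * normW2 (interior (cubeAt d t₀)) r f)
        ≤ d * ((2 * d * r / κ : ℝ) ^ r * C) := by
          have h1 : (2 * d : ℝ) ≤ 2 * d * r := le_mul_of_one_le_right (by positivity) hr1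
          have h2 : (2 * d / κ : ℝ) ≤ 2 * d * r / κ := by gcongr
          gcongr d * (?_ ^ r * ?_)
      _ = _ := by
          rw [div_pow]
          ring
  · -- for small `κ` the zero polynomial does
    refine ⟨0, by simp, ?_⟩
    have hfin : IsFiniteMeasure (volume.restrict (interior (cubeAt d t₀))) := by
      rw [restrict_interior_cubeAt]
      infer_instance
    have h0 := ae_eq_of_isWeakDerivL2_zero isOpen_interior hfin hf.1
      (isWeakDerivL2_weakDeriv hf (α := 0) (by simp))
    have h1 := (eLpNorm_weakDeriv_le_normW2 (U := interior (cubeAt d t₀)) (r := r) f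
      (α := 0) (by simp)).trans hC
    rw [← eLpNorm_congr_ae h0, restrict_interior_cubeAt] at h1
    simp only [map_zero, sub_zero]
    refine h1.trans ?_
    have h2 : (κ : ℝ) ≤ 2 * d * r := by exact_mod_cast h.le
    have h3 : (1 : ℝ) ≤ d * (2 * d * r) ^ r * ((κ : ℝ) ^ r)⁻¹ := by
      rw [mul_assoc, ← div_eq_mul_inv, ← div_pow]
      exact one_le_mul_of_one_le_of_one_le hd1
        (one_le_pow₀ ((one_le_div (by positivity)).2 h2))
    rw [mul_assoc]
    exact le_mul_of_one_le_right hC0 h3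

end LegendreSieve

/-! ### The projection onto the sieve space -/

namespace IndexSpace

variable {d m : ℕ}

theorem measurableSet_cube (S : IndexSpace d m) (j : Fin m) : MeasurableSet (S.cube j) :=
  measurableSet_Icc

theorem disjoint_cube (hd : 1 ≤ d) (S : IndexSpace d m) {i j : Fin m} (hij : i ≠ j) :
    Disjoint (S.cube i) (S.cube j) := by
  rw [Set.disjoint_left]
  intro x hi hj
  have h1 := LegendreSieve.mem_cubeAt.1 hi ⟨0, hd⟩
  have h2 := LegendreSieve.mem_cubeAt.1 hj ⟨0, hd⟩
  have h3 : ((i : ℕ) : ℝ) < (j : ℕ) + 1 := by linarith [h1.1, h1.2, h2.1, h2.2]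
  have h4 : ((j : ℕ) : ℝ) < (i : ℕ) + 1 := by linarith [h1.1, h1.2, h2.1, h2.2]
  norm_cast at h3 h4
  exact hij (Fin.ext (by omega))

theorem nu_restrict_cube (hd : 1 ≤ d) (S : IndexSpace d m) (j : Fin m) :
    S.nu.restrict (S.cube j) = volume.restrict (S.cube j) := by
  ext s hs
  rw [Measure.restrict_apply hs, Measure.restrict_apply hs]
  have hms := hs.inter (S.measurableSet_cube j)
  simp only [nu, Measure.coe_add, Measure.coe_finsetSum, Pi.add_apply, Finset.sum_apply]
  rw [Finset.sum_eq_single_of_mem j (Finset.mem_univ j) fun i _ hij => ?_,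
    Finset.sum_eq_zero fun t ht => ?_, add_zero, Measure.restrict_apply hms, Set.inter_assoc,
    Set.inter_self]
  · rw [Measure.dirac_apply' _ hms, Set.indicator_of_notMem]
    exact fun h => S.disjoint_cubes j t ht h.2
  · rw [Measure.restrict_apply hms, Set.inter_assoc,
      (S.disjoint_cube hd hij.symm).inter_eq, Set.inter_empty, measure_empty]

/-- The distance to the sieve space is at most the sum of the distances on the cubes; the values
at the atoms are unrestricted. -/
theorem norm_sub_starProjection_sieve_le (hd : 1 ≤ d) (S : IndexSpace d m) (J : Fin m → ℕ)
    (f : S.X) {ε : ℝ} (h : ∀ j, ∃ p : MvPolynomial (Fin d) ℝ, p.totalDegree ≤ J j ∧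
      (eLpNorm (fun x => f x - MvPolynomial.eval x p) 2 (volume.restrict (S.cube j))).toReal
        ≤ ε) :
    ‖f - (S.sieve J).starProjection f‖ ≤ m * ε := by
  choose p hp hle using h
  have hmem : ∀ j, MemLp ((S.cube j).indicator fun x => f x - MvPolynomial.eval x (p j)) 2 S.nu :=
    fun j => (memLp_indicator_iff_restrict (S.measurableSet_cube j)).2
      (((Lp.memLp f).restrict _).sub (S.memLp_eval j (p j)))
  set q : S.X := f - ∑ j, (hmem j).toLp _ with hq
  have hqs : q ∈ S.sieve J := by
    intro j
    refine ⟨p j, hp j, ?_⟩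
    have hall : ∀ᵐ x ∂S.nu, ∀ i, ((hmem i).toLp _ : S.X) x
        = (S.cube i).indicator (fun x => f x - MvPolynomial.eval x (p i)) x :=
      ae_all_iff.2 fun i => (hmem i).coeFn_toLp
    have hsum := Lp.coeFn_finsetSum (E := ℝ) Finset.univ fun i => (hmem i).toLp _
    filter_upwards [ae_restrict_of_ae (Lp.coeFn_sub f (∑ j, (hmem j).toLp _)),
      ae_restrict_of_ae hall, ae_restrict_of_ae hsum,
      self_mem_ae_restrict (S.measurableSet_cube j)] with x h1 h2 h3 hx
    rw [hq, h1, Pi.sub_apply, h3, Finset.sum_apply,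
      Finset.sum_eq_single_of_mem j (Finset.mem_univ j) fun i _ hij => ?_, h2,
      Set.indicator_of_mem hx, sub_sub_cancel]
    rw [h2, Set.indicator_of_notMem fun hxi => Set.disjoint_left.1 (S.disjoint_cube hd hij) hxi hx]
  have hmin : ‖f - (S.sieve J).starProjection f‖ ≤ ‖f - q‖ := by
    rw [Submodule.starProjection_minimal]
    exact ciInf_le ⟨0, by rintro _ ⟨_, rfl⟩; exact norm_nonneg _⟩ (⟨q, hqs⟩ : S.sieve J)
  refine hmin.trans ?_
  rw [hq, sub_sub_cancel]
  refine (norm_sum_le _ _).trans ((Finset.sum_le_sum fun j _ => ?_).trans_eq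
    (by simp : ∑ _ : Fin m, ε = m * ε))
  rw [Lp.norm_toLp, eLpNorm_indicator_eq_eLpNorm_restrict (S.measurableSet_cube j),
    nu_restrict_cube hd]
  exact hle j

/-- Smooth functions are approximated by the sieve spaces at the rate `κ⁻ʳ`. -/
theorem Smooth.projError_le (hd : 1 ≤ d) {S : IndexSpace d m} {𝒯 : Set (Fin d → ℝ)} [Nonempty 𝒯]
    {θ : Param 𝒯 S.X} {r : ℕ} (hr : 1 ≤ r) {C : ℝ} (hθ : S.Smooth θ r C) {J : Fin m → ℕ} {κ : ℕ}
    (hκ : 1 ≤ κ) (hJ : ∀ j, κ ≤ J j) :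
    θ.projError (S.sieve J) ≤ m * C * (2 * (d * (2 * d * r) ^ r)) * ((κ : ℝ) ^ r)⁻¹ := by
  have key : ∀ f : S.X, (∀ j, MemW2 (interior (S.cube j)) r f ∧
      normW2 (interior (S.cube j)) r f ≤ C) →
      ‖f - (S.sieve J).starProjection f‖
        ≤ m * (C * (d * (2 * d * r) ^ r) * ((κ : ℝ) ^ r)⁻¹) := fun f hf =>
    S.norm_sub_starProjection_sieve_le hd J f fun j => by
      obtain ⟨p, hp, hle⟩ := LegendreSieve.exists_eLpNorm_sub_le hd hr hκ (hf j).1 (hf j).2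
      exact ⟨p, hp.trans (hJ j), hle⟩
  have h1 := key θ.c hθ.c_mem
  have h2 : (⨆ t : 𝒯, ‖θ.a t - (S.sieve J).starProjection (θ.a t)‖)
      ≤ m * (C * (d * (2 * d * r) ^ r) * ((κ : ℝ) ^ r)⁻¹) :=
    ciSup_le fun t => key (θ.a t) (hθ.a_mem t)
  unfold Param.projError
  linarith

end IndexSpace

end

theorem theorem2 (d : ℕ) (hd : 1 ≤ d) :
    -- the two-sided perturbation bound
    (∀ (m : ℕ), 1 ≤ m → ∀ (S : IndexSpace d m) (𝒯 : Set (Fin d → ℝ)), IsCompact 𝒯 →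
      ∀ (θ θhat : Param 𝒯 S.X), S.Regular θ →
      ∀ (J : Fin m → ℕ) (γ : ℝ), 0 < γ →
      ∀ β : ℝ, (β = θ.primalValue ∨ β = θ.gotValue) →
        -(γ * (θ.errA θhat + θ.errC θhat)) - θ.errB θhat
            ≤ θhat.subspaceBallValue (S.sieve J) γ - β ∧
        θhat.subspaceBallValue (S.sieve J) γ - β
            ≤ γ * (θ.errA θhat + θ.errC θhat + θ.projError (S.sieve J)) + θ.errB θhat
              + (θ.ballValue γ - β)) ∧
    -- the bound on the projection error
    (∀ r : ℕ, 1 ≤ r → ∃ Ctilde : ℝ, 0 < Ctilde ∧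
      ∀ (m : ℕ), 1 ≤ m → ∀ (S : IndexSpace d m) (𝒯 : Set (Fin d → ℝ)), IsCompact 𝒯 →
      ∀ (θ : Param 𝒯 S.X), S.Regular θ →
      ∀ C : ℝ, 0 < C → S.Smooth θ r C →
      ∀ (J : Fin m → ℕ) (κ : ℕ), κ = ⨅ j, J j → r ≤ κ →
        θ.projError (S.sieve J) ≤ m * C * Ctilde * ((κ : ℝ) ^ r)⁻¹) := by
  refine ⟨fun m _ S 𝒯 h𝒯 θ θhat hθ J γ hγ β hβ => ?_, fun r hr =>
    ⟨2 * (d * (2 * d * r) ^ r), by positivity,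
      fun m _ S 𝒯 h𝒯 θ hθ C _ hC J κ hκ hrκ => ?_⟩⟩
  · have : CompactSpace 𝒯 := isCompact_iff_compactSpace.1 h𝒯
    obtain ⟨_, hpen⟩ := hθ.nonempty_and_le_penalty hd h𝒯 hβ
    have hlow := θ.le_subspaceBallValue_of_le_penalty θhat (S.sieve J) hγ.le hpen
    have hup := θ.subspaceBallValue_le_ballValue_add θhat (S.sieve J) hγ.le
    constructor <;> linarith
  · obtain ⟨_, -⟩ := hθ.nonempty_and_le_penalty hd h𝒯 (Or.inl rfl)
    exact hC.projError_le hd hr (hr.trans hrκ) fun j => hκ ▸ ciInf_le (OrderBot.bddBelow _) j
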